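/- **Theorem 4.1.** Let $\mathbf s=(s_i)_{i\ge1}$ and $\mathbf t=(t_j)_{j\ge1}$ be two countable sets of indeterminates. For a partition $\lambda$ of $n$ with $a_i$ parts of size $i$ and a partition $\nu$ of $n$ with $b_j$ parts of size $j$, put $\mathbf s^{c(\lambda)}=\prod_i s_i^{a_i}$ and $\mathbf t^{c(\nu)}=\prod_j t_j^{b_j}$. Let $x\in S_n$ have cycle type $\lambda$. Its centralizer is $Z_x\cong\prod_{i\ge1}G_i\wr S_{a_i}$, where $G_i$ is the cyclic group generated by an $i$-cycle and $S_{a_i}$ permutes the $i$-cycles of $x$, preserving a choice of base points on them. Let $\omega^x$ be the linear character of $Z_x$ which restricts to a primitive (that is, faithful) irreducible character on each copy of $G_i$ (the same one for all the $i$-cycles of $x$) and is trivial on each $S_{a_i}$. The higher Lie character $\psi^\lambda_{S_n}=\omega^x\uparrow_{Z_x}^{S_n}$ is the induced character. Let $\psi^\lambda_{S_n}(\nu)$, $\operatorname{sign}(\nu)$ and $|Z_\nu|$ denote the value of $\psi^\lambda_{S_n}$ at, the sign of, and the order of the centralizer in $S_n$ of, an element of $S_n$ of cycle type $\nu$. Then,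 for any choice of the elements $x$ and of the primitive characters, in the ring of formal power series $\mathbb C[[\mathbf s,\mathbf t]]$, $$\sum_{n\ge0}\ \sum_{\lambda\vdash n}\ \sum_{\nu\vdash n}\operatorname{sign}(\nu)\,\psi^\lambda_{S_n}(\nu)\,\frac{\mathbf s^{c(\lambda)}\mathbf t^{c(\nu)}}{|Z_\nu|}=\exp\left(\sum_{i\ge1}\sum_{j\ge1}\sum_{e\mid\gcd(i,j)}(-1)^{i(j-1)/e}\,\mu(e)\,\frac{s_i^{j/e}\,t_j^{i/e}}{ij/e}\right),$$ where $\mu$ is the classical Möbius function (and for $n=0$ the only partition is the empty one, whose term is $1$). -/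

import Mathlib

open Equiv

noncomputable section

/-! ### Formal sums of power series -/

/-- A family of formal power series is (formally) summable if every monomial occurs in only
finitely many members of the family. -/
def FormallySummable {κ σ : Type*} (f : κ → MvPowerSeries σ ℂ) : Prop :=
  ∀ m : σ →₀ ℕ, {k : κ | MvPowerSeries.coeff m (f k) ≠ 0}.Finite

/-- The coefficientwise sum of a (formally summable) family of formal power series. -/
def formalSum {κ σ : Type*} (f : κ → MvPowerSeries σ ℂ) : MvPowerSeries σ ℂ :=
  fun m => ∑ᶠ k, MvPowerSeries.coeff m (f k)

/-- The family `f` is formally summable with sum `F`. -/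
def HasFormalSum {κ σ : Type*} (f : κ → MvPowerSeries σ ℂ) (F : MvPowerSeries σ ℂ) : Prop :=
  FormallySummable f ∧ formalSum f = F

/-- The exponential `exp F = ∑ F ^ k / k!` of a formal power series `F` (meaningful when
`PowerSeries.HasSubst F` holds, in particular when `F` has constant term zero). -/
def formalExp {σ : Type*} (F : MvPowerSeries σ ℂ) : MvPowerSeries σ ℂ :=
  (PowerSeries.exp ℂ).subst F

/-! ### Indeterminates `s_i`, `t_j` (`i, j ≥ 1`) and the monomials attached to partitions -/

/-- The ring `ℂ[[s, t]]` in the indeterminates `s_i` and `t_j`, `i, j ≥ 1`. -/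
abbrev SeriesST : Type := MvPowerSeries (ℕ+ ⊕ ℕ+) ℂ

/-- The indeterminate `s_i`. -/
def sVar (i : ℕ+) : SeriesST := MvPowerSeries.X (Sum.inl i)

/-- The indeterminate `t_j`. -/
def tVar (j : ℕ+) : SeriesST := MvPowerSeries.X (Sum.inr j)

/-- `s^{c(lam)} = ∏_i s_i ^ a_i`, where `a_i` is the number of parts of `lam` equal to `i`. -/
def sMonomial {n : ℕ} (lam : n.Partition) : SeriesST :=
  ∏ᶠ i : ℕ+, sVar i ^ lam.parts.count (i : ℕ)

/-- `t^{c(nu)} = ∏_j t_j ^ b_j`, where `b_j` is the number of parts of `nu` equal to `j`. -/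
def tMonomial {n : ℕ} (nu : n.Partition) : SeriesST :=
  ∏ᶠ j : ℕ+, tVar j ^ nu.parts.count (j : ℕ)

/-! ### Induced characters -/

open Classical in
/-- The character of `G` induced from a linear character `χ` of a subgroup `H`:
`g ↦ |H|⁻¹ ∑_{a ∈ G} χ⁰(a⁻¹ g a)`, where `χ⁰` is `χ` extended by zero. -/
def inducedCharacter {G : Type*} [Group G] [Fintype G] (H : Subgroup G) (χ : H →* ℂ) (g : G) : ℂ :=
  (Nat.card H : ℂ)⁻¹ * ∑ a : G, if h : a⁻¹ * g * a ∈ H then χ ⟨a⁻¹ * g * a, h⟩ else 0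

/-! ### Higher Lie characters of the symmetric group -/

/-- The permutation `x` of `{0, …, n-1}` has cycle type `lam` (fixed points are parts `1`). -/
def HasCycleType {n : ℕ} (x : Perm (Fin n)) (lam : n.Partition) : Prop :=
  x.partition.parts = lam.parts

section LinearCharacter

set_option linter.unusedSectionVars false

variable {α : Type*} [Fintype α] [DecidableEq α]

/-- A chosen base point on the cycle of `x` through `p` (fixed points are cycles of length one). -/
def cycleBase (x : Perm α) (p : α) : α :=
  (Quotient.mk (Perm.SameCycle.setoid x) p).out

/-- The base points of all the cycles of `x`: one point on each cycle. -/
def cycleBases (x : Perm α) : Finset α :=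
  Finset.univ.filter fun p => cycleBase x p = p

/-- If `z` maps the cycle of `x` through `p` onto a cycle with base point `q`, this is the least
`k` with `z p = x ^ k q`. For a base point `p` and `z` in the centralizer of `x`, it is (the
exponent of) the `G_i`-coordinate of `z` at that cycle, when the centralizer of the product of the
`i`-cycles of `x` is identified with the wreath product `G_i ≀ S_{a_i}`: here `G_i` is generated by
an `i`-cycle and `S_{a_i}` is the group of all permutations which commute with `x` and permute the
base points of the `i`-cycles. -/
def cycleShift (x z : Perm α) (p : α) : ℕ :=
  sInf {k : ℕ | (x ^ k) (cycleBase x (z p)) = z p}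

theorem cycleBase_sameCycle (x : Perm α) (p : α) : x.SameCycle (cycleBase x p) p :=
  Quotient.mk_out (s := Perm.SameCycle.setoid x) p

theorem cycleBase_eq_iff (x : Perm α) (p q : α) :
    cycleBase x p = cycleBase x q ↔ x.SameCycle p q := by
  constructor
  · intro h
    exact (cycleBase_sameCycle x p).symm.trans (h ▸ cycleBase_sameCycle x q)
  · intro h
    unfold cycleBase
    rw [Quotient.sound (s := Perm.SameCycle.setoid x) h]

theorem cycleBase_mem (x : Perm α) (p : α) : cycleBase x p ∈ cycleBases x := by
  simpa [cycleBases] using (cycleBase_eq_iff x _ _).2 (cycleBase_sameCycle x p)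

theorem cycleShift_spec (x z : Perm α) (p : α) :
    (x ^ cycleShift x z p) (cycleBase x (z p)) = z p := by
  have h : {k : ℕ | (x ^ k) (cycleBase x (z p)) = z p}.Nonempty := by
    obtain ⟨k, -, hk⟩ := (cycleBase_sameCycle x (z p)).exists_pow_eq'
    exact ⟨k, hk⟩
  exact Nat.sInf_mem h

theorem root_pow_eq_of_pow_apply_eq (x : Perm α) (ζ : ℕ → ℂ)
    (hζ : ∀ i, 0 < i → IsPrimitiveRoot (ζ i) i) {q : α} {k l : ℕ}
    (h : (x ^ k) q = (x ^ l) q) :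
    ζ (Function.minimalPeriod x q) ^ k = ζ (Function.minimalPeriod x q) ^ l := by
  have hper : q ∈ Function.periodicPts x :=
    Function.mem_periodicPts.2 ⟨orderOf x, orderOf_pos x, by
      simp [Function.IsPeriodicPt, Function.IsFixedPt, ← Perm.coe_pow, pow_orderOf_eq_one]⟩
  have hpos := Function.minimalPeriod_pos_of_mem_periodicPts hper
  have hprim := hζ _ hpos
  have h' : x^[k] q = x^[l] q := by simpa [← Perm.coe_pow] using h
  have hmod : k % Function.minimalPeriod x q = l % Function.minimalPeriod x q := by
    rw [← Function.iterate_mod_minimalPeriod_eq (n := k),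
      ← Function.iterate_mod_minimalPeriod_eq (n := l)] at h'
    exact Function.iterate_injOn_Iio_minimalPeriod (Set.mem_Iio.2 (Nat.mod_lt _ hpos))
      (Set.mem_Iio.2 (Nat.mod_lt _ hpos)) h'
  rw [← Nat.mod_add_div k (Function.minimalPeriod x q),
    ← Nat.mod_add_div l (Function.minimalPeriod x q), pow_add, pow_add, pow_mul, pow_mul,
    hprim.pow_eq_one, one_pow, one_pow, hmod]

theorem minimalPeriod_conj_eq {x z : Perm α} (hz : Commute z x) (p : α) :
    Function.minimalPeriod x (z p) = Function.minimalPeriod x p := by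
  have key : ∀ k : ℕ, Function.IsPeriodicPt x k (z p) ↔ Function.IsPeriodicPt x k p := by
    intro k
    have : (x ^ k) (z p) = z ((x ^ k) p) := by
      rw [← Perm.mul_apply, ← Perm.mul_apply, (hz.pow_right k).eq]
    simp only [Function.IsPeriodicPt, Function.IsFixedPt, ← Perm.coe_pow, this,
      EmbeddingLike.apply_eq_iff_eq]
  exact Nat.dvd_antisymm
    ((Function.isPeriodicPt_iff_minimalPeriod_dvd).1
      ((key _).2 (Function.isPeriodicPt_minimalPeriod x p)))
    ((Function.isPeriodicPt_iff_minimalPeriod_dvd).1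
      ((key _).1 (Function.isPeriodicPt_minimalPeriod x (z p))))

theorem minimalPeriod_cycleBase (x : Perm α) (p : α) :
    Function.minimalPeriod x (cycleBase x p) = Function.minimalPeriod x p := by
  obtain ⟨k, -, hk⟩ := (cycleBase_sameCycle x p).exists_pow_eq'
  have h := minimalPeriod_conj_eq ((Commute.refl x).pow_left k) (cycleBase x p)
  rw [hk] at h
  exact h.symm

theorem sameCycle_map {x z : Perm α} (hz : Commute z x) {p q : α} (h : x.SameCycle p q) :
    x.SameCycle (z p) (z q) := by
  obtain ⟨k, hk⟩ := h
  refine ⟨k, ?_⟩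
  rw [← hk, ← Perm.mul_apply, ← Perm.mul_apply, (hz.zpow_right k).eq]

/-- The linear character `ω^x` on the centralizer of `x`. Under the identification of the
centralizer with the product of the wreath products `G_i ≀ S_{a_i}`, it is trivial on each `S_{a_i}`
and restricts on each copy of `G_i` to the primitive character mapping the generating `i`-cycle
to the primitive `i`-th root of unity `ζ i`. -/
def higherLieLinear (x : Perm α) (ζ : ℕ → ℂ) (hζ : ∀ i, 0 < i → IsPrimitiveRoot (ζ i) i) :
    Subgroup.centralizer {x} →* ℂ where
  toFun z := ∏ p ∈ cycleBases x, ζ (Function.minimalPeriod x p) ^ cycleShift x z p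
  map_one' := by
    refine Finset.prod_eq_one fun p hp => ?_
    have hp' : cycleBase x p = p := by simpa [cycleBases] using hp
    have h := cycleShift_spec x 1 p
    rw [Perm.one_apply, hp'] at h
    have h0 : (x ^ cycleShift x 1 p) p = (x ^ 0) p := by simpa using h
    simpa using root_pow_eq_of_pow_apply_eq x ζ hζ h0
  map_mul' z w := by
    have hz : Commute (z : Perm α) x :=
      (Subgroup.mem_centralizer_iff.1 z.2 x rfl).symm
    have hw : Commute (w : Perm α) x :=
      (Subgroup.mem_centralizer_iff.1 w.2 x rfl).symm
    have hfac : ∀ p ∈ cycleBases x,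
        ζ (Function.minimalPeriod x p) ^ cycleShift x ((z * w : Subgroup.centralizer {x}) : Perm α) p
          = ζ (Function.minimalPeriod x (cycleBase x ((w : Perm α) p))) ^
              cycleShift x z (cycleBase x ((w : Perm α) p)) *
            ζ (Function.minimalPeriod x p) ^ cycleShift x w p := by
      intro p _
      have h1 := cycleShift_spec x w p
      have h2 := cycleShift_spec x z (cycleBase x ((w : Perm α) p))
      have h3 := cycleShift_spec x ((z * w : Subgroup.centralizer {x}) : Perm α) p
      have hb : cycleBase x ((z : Perm α) (cycleBase x ((w : Perm α) p)))
          = cycleBase x (((z * w : Subgroup.centralizer {x}) : Perm α) p) :=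
        (cycleBase_eq_iff x _ _).2 (sameCycle_map hz (cycleBase_sameCycle x _))
      have hper : Function.minimalPeriod x
          (cycleBase x (((z * w : Subgroup.centralizer {x}) : Perm α) p))
          = Function.minimalPeriod x p := by
        rw [minimalPeriod_cycleBase]
        exact (minimalPeriod_conj_eq hz _).trans (minimalPeriod_conj_eq hw _)
      have hper' : Function.minimalPeriod x (cycleBase x ((w : Perm α) p))
          = Function.minimalPeriod x p := by
        rw [minimalPeriod_cycleBase]; exact minimalPeriod_conj_eq hw _
      rw [hper', ← hper, mul_comm, ← pow_add]
      apply root_pow_eq_of_pow_apply_eq x ζ hζ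
      rw [h3, pow_add, Perm.mul_apply, ← hb, h2, ← Perm.mul_apply,
        ← (hz.pow_right _).eq, Perm.mul_apply, h1]
      rfl
    rw [Finset.prod_congr rfl hfac, Finset.prod_mul_distrib]
    congr 1
    have hmaps : ∀ p ∈ cycleBases x, cycleBase x ((w : Perm α) p) ∈ cycleBases x :=
      fun p _ => cycleBase_mem x _
    have hinj : Set.InjOn (fun p => cycleBase x ((w : Perm α) p)) (cycleBases x) := by
      intro p hp q hq hpq
      have hp' : cycleBase x p = p := by simpa [cycleBases] using hp
      have hq' : cycleBase x q = q := by simpa [cycleBases] using hq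
      have h := sameCycle_map hw.inv_left ((cycleBase_eq_iff x _ _).1 hpq)
      rw [← Perm.mul_apply, ← Perm.mul_apply, inv_mul_cancel, Perm.one_apply, Perm.one_apply] at h
      rw [← hp', ← hq']
      exact (cycleBase_eq_iff x _ _).2 h
    exact Finset.prod_bij (fun p _ => cycleBase x ((w : Perm α) p)) hmaps
      (fun p hp q hq h => hinj hp hq h)
      (fun q hq => by
        obtain ⟨p, hp, h⟩ := Finset.surjOn_of_injOn_of_card_le _ hmaps hinj le_rfl hq
        exact ⟨p, hp, h⟩)
      (fun _ _ => rfl)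

/-- The higher Lie character `ψ^x`: the character induced from `ω^x` on the centralizer of `x`
to the whole symmetric group. -/
def higherLieCharacter (x : Perm α) (ζ : ℕ → ℂ) (hζ : ∀ i, 0 < i → IsPrimitiveRoot (ζ i) i)
    (g : Perm α) : ℂ :=
  inducedCharacter (Subgroup.centralizer {x}) (higherLieLinear x ζ hζ) g

end LinearCharacter

/-- The summand of the exponent at `(i, j)`:
`∑_{e ∣ gcd(i,j)} (-1)^{i(j-1)/e} μ(e) s_i^{j/e} t_j^{i/e} / (ij/e)`
(all divisions in exponents are exact). -/
def signedExponentTerm (ij : ℕ+ × ℕ+) : SeriesST :=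
  ∑ e ∈ (Nat.gcd ij.1 ij.2).divisors,
    (((-1) ^ ((ij.1 : ℕ) * ((ij.2 : ℕ) - 1) / e) * (ArithmeticFunction.moebius e : ℂ))
        / ((ij.1 : ℂ) * (ij.2 : ℂ) / (e : ℂ))) •
      (sVar ij.1 ^ ((ij.2 : ℕ) / e) * tVar ij.2 ^ ((ij.1 : ℕ) / e))

end

/-! Replacing `t_j` by `(-1)^(j-1) t_j` absorbs the sign. Summing over classes `ν` gives `1/n!`
times a sum over all permutations, and unfolding the induced character turns this into `|Z_x|⁻¹`
times a sum over `z ∈ Z_x` of `ω^x(z)` times the cycle monomial of `z`. Summing over classes `λ` in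
the same way gives `A_n = (1/n!) ∑ ω^x(z) s^{c(x)} t^{c(z)}`, over all commuting pairs `(x, z)` and
with signed `t` (`sum_higherLieCharacter`, `sum_smul_centralizerSum`).

A commuting pair is an action of `ℤ²`, and its weight is multiplicative over disjoint unions, so an
exponential formula applies. A transitive action with a marked point is described by `(i, m, c)`:
`z` cyclically permutes `m` cycles of `x` of length `i`, and `z^m = x^c`. Its character value is
`ζ_i^c`. If `c` has order `d` in `ℤ/i`, then `z` has `i/d` cycles, all of length `md`. The sum of
`ζ_i^c` over `c` of order `d` is `μ(d)`, which produces the exponent after setting `e = d` and `j =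
md`.

Marking a point gives `n A_n = ∑ T(i,m) A_{n-im}` (`smul_normalizedSum`), where `T(i,m)` is the
total weight of the transitive types. Let `D` multiply a monomial by its weight, with `s_i` of
weight `i` and `t_j` of weight `j`. The recurrence then reads `D F = (D G) F`, where `F = ∑ A_n` and
`G` is the exponent. The series `exp G` satisfies the same equation with the same constant term,
hence `F = exp G`.

The characters `ζ` may vary with `λ`, but the `s`-exponents of a monomial determine `λ`, so each
coefficient can be computed with a single choice of `ζ` (`exists_coeff_sum_eq`). -/

noncomputable section

/-! ### Cycle transversals, cycle products, and base-point independence of `ω^x` -/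

section Transversal

set_option linter.unusedSectionVars false

variable {α β : Type*} [Fintype α] [DecidableEq α] [Fintype β] [DecidableEq β]

/-- `B` contains exactly one point of each cycle of `x`. -/
def IsTransversal (x : Perm α) (B : Finset α) : Prop :=
  ∀ p, ∃! q, q ∈ B ∧ x.SameCycle p q

theorem isTransversal_cycleBases (x : Perm α) : IsTransversal x (cycleBases x) := by
  intro p
  refine ⟨cycleBase x p, ⟨cycleBase_mem x p, (cycleBase_sameCycle x p).symm⟩, ?_⟩
  rintro q ⟨hq, hpq⟩
  have hq' : cycleBase x q = q := by simpa [cycleBases] using hq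
  rw [← hq']
  exact ((cycleBase_eq_iff x _ _).2 hpq).symm

theorem eq_of_sameCycle_of_forall_apply_eq {M : Type*} {x : Perm α} {f : α → M}
    (hf : ∀ p, f (x p) = f p) {p q : α} (h : x.SameCycle p q) : f p = f q := by
  obtain ⟨k, -, rfl⟩ := h.exists_pow_eq'
  clear h
  induction k with
  | zero => simp
  | succ k ih => rw [pow_succ', Perm.mul_apply, hf, ih]

theorem IsTransversal.prod_eq {M : Type*} [CommMonoid M] {x : Perm α} {B B' : Finset α}
    (hB : IsTransversal x B) (hB' : IsTransversal x B') {f : α → M}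
    (hf : ∀ p, f (x p) = f p) : ∏ p ∈ B, f p = ∏ p ∈ B', f p := by
  refine Finset.prod_bij (fun p _ => (hB' p).choose) (fun p _ => (hB' p).choose_spec.1.1) ?_ ?_ ?_
  · intro p hp q hq h
    have h1 := (hB' p).choose_spec.1.2
    have h2 := (hB' q).choose_spec.1.2
    rw [h] at h1
    exact (hB p).unique ⟨hp, Perm.SameCycle.refl _ _⟩ ⟨hq, h1.trans h2.symm⟩
  · intro q hq
    refine ⟨(hB q).choose, (hB q).choose_spec.1.1, ?_⟩
    exact (hB' _).unique (hB' _).choose_spec.1 ⟨hq, (hB q).choose_spec.1.2.symm⟩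
  · intro p _
    exact eq_of_sameCycle_of_forall_apply_eq hf (hB' p).choose_spec.1.2

theorem permCongr_zpow (e : α ≃ β) (x : Perm α) (k : ℤ) :
    e.permCongr x ^ k = e.permCongr (x ^ k) :=
  (map_zpow e.permCongrHom x k).symm

theorem sameCycle_permCongr (e : α ≃ β) (x : Perm α) (p q : α) :
    (e.permCongr x).SameCycle (e p) (e q) ↔ x.SameCycle p q := by
  simp [Perm.SameCycle, permCongr_zpow]

theorem IsTransversal.map {x : Perm α} {B : Finset α} (hB : IsTransversal x B) (e : α ≃ β) :
    IsTransversal (e.permCongr x) (B.map e.toEmbedding) := by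
  intro p
  obtain ⟨p, rfl⟩ := e.surjective p
  obtain ⟨q, ⟨hq, hpq⟩, hu⟩ := hB p
  refine ⟨e q, ⟨by simpa using hq, (sameCycle_permCongr e x p q).2 hpq⟩, ?_⟩
  rintro r ⟨hr, hpr⟩
  obtain ⟨r, rfl⟩ := e.surjective r
  rw [hu r ⟨by simpa using hr, (sameCycle_permCongr e x p r).1 hpr⟩]

theorem sumCongr_zpow (x : Perm α) (y : Perm β) (k : ℤ) :
    Perm.sumCongr x y ^ k = Perm.sumCongr (x ^ k) (y ^ k) :=
  (map_zpow (Perm.sumCongrHom α β) (x, y) k).symm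

theorem IsTransversal.disjSum {x : Perm α} {y : Perm β} {B : Finset α} {C : Finset β}
    (hB : IsTransversal x B) (hC : IsTransversal y C) :
    IsTransversal (Perm.sumCongr x y) (B.disjSum C) := by
  rintro (p | p)
  · obtain ⟨q, ⟨hq, k, hk⟩, hu⟩ := hB p
    refine ⟨Sum.inl q, ⟨by simpa using hq, k, by simp [sumCongr_zpow, hk]⟩, ?_⟩
    rintro (r | r) ⟨hr, l, hl⟩
    · rw [hu r ⟨by simpa using hr, l, by simpa [sumCongr_zpow] using hl⟩]
    · simp [sumCongr_zpow] at hl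
  · obtain ⟨q, ⟨hq, k, hk⟩, hu⟩ := hC p
    refine ⟨Sum.inr q, ⟨by simpa using hq, k, by simp [sumCongr_zpow, hk]⟩, ?_⟩
    rintro (r | r) ⟨hr, l, hl⟩
    · simp [sumCongr_zpow] at hl
    · rw [hu r ⟨by simpa using hr, l, by simpa [sumCongr_zpow] using hl⟩]

theorem isPeriodicPt_perm_iff (x : Perm α) (k : ℕ) (p : α) :
    Function.IsPeriodicPt x k p ↔ (x ^ k) p = p := by
  rw [Function.IsPeriodicPt, Function.IsFixedPt, ← Perm.coe_pow]

theorem pow_apply_eq_self_iff_minimalPeriod_dvd (x : Perm α) (k : ℕ) (p : α) :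
    (x ^ k) p = p ↔ Function.minimalPeriod x p ∣ k := by
  rw [← isPeriodicPt_perm_iff, Function.isPeriodicPt_iff_minimalPeriod_dvd]

theorem minimalPeriod_perm_pos (x : Perm α) (p : α) : 0 < Function.minimalPeriod x p :=
  Function.minimalPeriod_pos_of_mem_periodicPts <|
    Function.mem_periodicPts.2 ⟨orderOf x, orderOf_pos x, by
      simp [isPeriodicPt_perm_iff, pow_orderOf_eq_one]⟩

/-- An injective map intertwining two permutations preserves the periods of points. -/
theorem minimalPeriod_of_intertwining {x : Perm α} {y : Perm β} {f : α → β}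
    (hf : Function.Injective f) (h : ∀ p, f (x p) = y (f p)) (p : α) :
    Function.minimalPeriod y (f p) = Function.minimalPeriod x p := by
  have key (k : ℕ) : (y ^ k) (f p) = f ((x ^ k) p) := by
    induction k with
    | zero => simp
    | succ k ih => rw [pow_succ', pow_succ', Perm.mul_apply, Perm.mul_apply, h, ih]
  refine Nat.dvd_antisymm ?_ ?_
  · rw [← pow_apply_eq_self_iff_minimalPeriod_dvd, key,
      (pow_apply_eq_self_iff_minimalPeriod_dvd x _ p).2 dvd_rfl]
  · rw [← pow_apply_eq_self_iff_minimalPeriod_dvd, ← hf.eq_iff, ← key,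
      (pow_apply_eq_self_iff_minimalPeriod_dvd y _ _).2 dvd_rfl]

theorem minimalPeriod_apply_self (x : Perm α) (p : α) :
    Function.minimalPeriod x (x p) = Function.minimalPeriod x p :=
  minimalPeriod_of_intertwining x.injective (fun _ => rfl) p

theorem minimalPeriod_permCongr (e : α ≃ β) (x : Perm α) (p : α) :
    Function.minimalPeriod (e.permCongr x) (e p) = Function.minimalPeriod x p :=
  minimalPeriod_of_intertwining e.injective (by simp) p

theorem minimalPeriod_sumCongr_inl (x : Perm α) (y : Perm β) (p : α) :
    Function.minimalPeriod (Perm.sumCongr x y) (Sum.inl p) = Function.minimalPeriod x p :=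
  minimalPeriod_of_intertwining Sum.inl_injective (by simp) p

theorem minimalPeriod_sumCongr_inr (x : Perm α) (y : Perm β) (p : β) :
    Function.minimalPeriod (Perm.sumCongr x y) (Sum.inr p) = Function.minimalPeriod y p :=
  minimalPeriod_of_intertwining Sum.inr_injective (by simp) p

/-- The product of `f` over the lengths of the cycles of `x`. -/
def cycleProd {M : Type*} [CommMonoid M] (f : ℕ → M) (x : Perm α) : M :=
  ∏ p ∈ cycleBases x, f (Function.minimalPeriod x p)

section CycleProd

variable {M : Type*} [CommMonoid M] (f : ℕ → M)

theorem IsTransversal.prod_minimalPeriod {x : Perm α} {B : Finset α} (hB : IsTransversal x B) :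
    ∏ p ∈ B, f (Function.minimalPeriod x p) = cycleProd f x :=
  hB.prod_eq (isTransversal_cycleBases x) fun p => by rw [minimalPeriod_apply_self]

theorem cycleProd_permCongr (e : α ≃ β) (x : Perm α) :
    cycleProd f (e.permCongr x) = cycleProd f x := by
  rw [← ((isTransversal_cycleBases x).map e).prod_minimalPeriod, Finset.prod_map]
  exact Finset.prod_congr rfl fun p _ => by rw [← minimalPeriod_permCongr e x p]; rfl

theorem cycleProd_sumCongr (x : Perm α) (y : Perm β) :
    cycleProd f (Perm.sumCongr x y) = cycleProd f x * cycleProd f y := by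
  rw [← ((isTransversal_cycleBases x).disjSum (isTransversal_cycleBases y)).prod_minimalPeriod,
    Finset.prod_disjSum]
  simp only [minimalPeriod_sumCongr_inl, minimalPeriod_sumCongr_inr, cycleProd]

end CycleProd

/-- `θ` is multiplied by `ζ i` along each cycle of `x` of length `i`. -/
structure IsPhase (ζ : ℕ → ℂ) (x : Perm α) (θ : α → ℂ) : Prop where
  ne_zero : ∀ p, θ p ≠ 0
  apply_eq : ∀ p, θ (x p) = ζ (Function.minimalPeriod x p) * θ p

/-- The value of the linear character `ω^x` at `z`. -/
def linearValue (ζ : ℕ → ℂ) (x z : Perm α) : ℂ :=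
  ∏ p ∈ cycleBases x, ζ (Function.minimalPeriod x p) ^ cycleShift x z p

variable {ζ : ℕ → ℂ}

theorem IsPhase.pow_apply {x : Perm α} {θ : α → ℂ} (h : IsPhase ζ x θ) (k : ℕ) (p : α) :
    θ ((x ^ k) p) = ζ (Function.minimalPeriod x p) ^ k * θ p := by
  induction k with
  | zero => simp
  | succ k ih =>
    have : Function.minimalPeriod x ((x ^ k) p) = Function.minimalPeriod x p :=
      minimalPeriod_conj_eq ((Commute.refl x).pow_left k) p
    rw [pow_succ', Perm.mul_apply, h.apply_eq, ih, this, pow_succ]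
    ring

/-- Count steps along the cycle from its base point. Going once around a cycle of length `i`
multiplies by `ζ i ^ i = 1`, so the phase is consistent. -/
theorem exists_isPhase (hζ : ∀ i, 0 < i → IsPrimitiveRoot (ζ i) i) (x : Perm α) :
    ∃ θ, IsPhase ζ x θ := by
  refine ⟨fun p => ζ (Function.minimalPeriod x p) ^ cycleShift x 1 p, ?_, ?_⟩
  · exact fun p => pow_ne_zero _ ((hζ _ (minimalPeriod_perm_pos x p)).ne_zero
      (minimalPeriod_perm_pos x p).ne')
  · intro p
    rw [minimalPeriod_apply_self, ← pow_succ', ← minimalPeriod_cycleBase]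
    apply root_pow_eq_of_pow_apply_eq x ζ hζ
    have h1 := cycleShift_spec x 1 p
    have h2 := cycleShift_spec x 1 (x p)
    have h3 : cycleBase x (x p) = cycleBase x p :=
      (cycleBase_eq_iff x _ _).2 (Perm.sameCycle_apply_left.2 (Perm.SameCycle.refl _ _))
    rw [Perm.one_apply] at h1 h2
    rw [h3] at h2
    rw [pow_succ', Perm.mul_apply, h1, h2]

theorem prod_cycleBase_apply {M : Type*} [CommMonoid M] {x z : Perm α} (hz : Commute z x)
    (f : α → M) : ∏ p ∈ cycleBases x, f (cycleBase x (z p)) = ∏ p ∈ cycleBases x, f p := by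
  have hmaps : ∀ p ∈ cycleBases x, cycleBase x (z p) ∈ cycleBases x :=
    fun p _ => cycleBase_mem x _
  have hinj : Set.InjOn (fun p => cycleBase x (z p)) (cycleBases x) := by
    intro p hp q hq hpq
    have h := sameCycle_map hz.inv_left ((cycleBase_eq_iff x _ _).1 hpq)
    rw [← Perm.mul_apply, ← Perm.mul_apply, inv_mul_cancel, Perm.one_apply, Perm.one_apply] at h
    exact (isTransversal_cycleBases x p).unique ⟨hp, Perm.SameCycle.refl _ _⟩ ⟨hq, h⟩
  exact Finset.prod_bij (fun p _ => cycleBase x (z p)) hmaps (fun p hp q hq h => hinj hp hq h)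
    (fun q hq => by
      obtain ⟨p, hp, h⟩ := Finset.surjOn_of_injOn_of_card_le _ hmaps hinj le_rfl hq
      exact ⟨p, hp, h⟩)
    (fun _ _ => rfl)

theorem IsPhase.zeta_ne_zero {x : Perm α} {θ : α → ℂ} (h : IsPhase ζ x θ) (p : α) :
    ζ (Function.minimalPeriod x p) ≠ 0 := fun h0 =>
  h.ne_zero (x p) (by rw [h.apply_eq, h0, zero_mul])

/-- The value of `ω^x` does not depend on the base points. -/
theorem IsPhase.prod_div_eq {x z : Perm α} {θ : α → ℂ} (h : IsPhase ζ x θ) (hz : Commute z x)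
    {B : Finset α} (hB : IsTransversal x B) : ∏ p ∈ B, θ (z p) / θ p = linearValue ζ x z := by
  -- The quotient `θ (z p) / θ p` is constant on cycles of `x` because `z` commutes with `x`, so any
  -- transversal may be used.
  rw [hB.prod_eq (isTransversal_cycleBases x)]
  · have h1 : ∀ p, θ (z p) / θ p = ζ (Function.minimalPeriod x p) ^ cycleShift x z p *
        (θ (cycleBase x (z p)) / θ p) := by
      intro p
      conv_lhs => rw [← cycleShift_spec x z p]
      rw [h.pow_apply, minimalPeriod_cycleBase, minimalPeriod_conj_eq hz, mul_div_assoc]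
    simp_rw [h1]
    -- Since `z` permutes the cycles, the phases at the target base points cancel those at the
    -- source base points.
    rw [Finset.prod_mul_distrib, Finset.prod_div_distrib, prod_cycleBase_apply hz θ, div_self,
      mul_one, linearValue]
    exact Finset.prod_ne_zero_iff.2 fun p _ => h.ne_zero p
  · intro p
    have h1 : z (x p) = x (z p) := by rw [← Perm.mul_apply, hz.eq, Perm.mul_apply]
    rw [h1, h.apply_eq, h.apply_eq, minimalPeriod_conj_eq hz,
      mul_div_mul_left _ _ (h.zeta_ne_zero p)]

/-- The base points chosen for the conjugate need not be the images of those for `x`. Transporting a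
phase, and evaluating on the transported transversal, avoids comparing them. -/
theorem linearValue_permCongr (hζ : ∀ i, 0 < i → IsPrimitiveRoot (ζ i) i) (e : α ≃ β)
    {x z : Perm α} (hz : Commute z x) :
    linearValue ζ (e.permCongr x) (e.permCongr z) = linearValue ζ x z := by
  obtain ⟨θ, hθ⟩ := exists_isPhase hζ x
  have hθ' : IsPhase ζ (e.permCongr x) (θ ∘ e.symm) := by
    refine ⟨fun p => hθ.ne_zero _, fun p => ?_⟩
    obtain ⟨p, rfl⟩ := e.surjective p
    simp [minimalPeriod_permCongr, hθ.apply_eq]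
  have hz' : Commute (e.permCongr z) (e.permCongr x) := hz.map e.permCongrHom
  rw [← hθ'.prod_div_eq hz' ((isTransversal_cycleBases x).map e),
    ← hθ.prod_div_eq hz (isTransversal_cycleBases x), Finset.prod_map]
  simp

theorem linearValue_sumCongr (hζ : ∀ i, 0 < i → IsPrimitiveRoot (ζ i) i)
    {x z : Perm α} (hz : Commute z x) {x' z' : Perm β} (hz' : Commute z' x') :
    linearValue ζ (Perm.sumCongr x x') (Perm.sumCongr z z') =
      linearValue ζ x z * linearValue ζ x' z' := by
  obtain ⟨θ, hθ⟩ := exists_isPhase hζ x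
  obtain ⟨θ', hθ'⟩ := exists_isPhase hζ x'
  have h : IsPhase ζ (Perm.sumCongr x x') (Sum.elim θ θ') := by
    constructor
    · rintro (p | p)
      exacts [hθ.ne_zero p, hθ'.ne_zero p]
    · rintro (p | p)
      · simp [minimalPeriod_sumCongr_inl, hθ.apply_eq]
      · simp [minimalPeriod_sumCongr_inr, hθ'.apply_eq]
  have hc : Commute (Perm.sumCongr z z') (Perm.sumCongr x x') := by
    simp [commute_iff_eq, Perm.sumCongr_mul, hz.eq, hz'.eq]
  rw [← h.prod_div_eq hc ((isTransversal_cycleBases x).disjSum (isTransversal_cycleBases x')),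
    ← hθ.prod_div_eq hz (isTransversal_cycleBases x),
    ← hθ'.prod_div_eq hz' (isTransversal_cycleBases x'), Finset.prod_disjSum]
  simp

end Transversal

/-! ### Weighted counting of commuting pairs with a marked orbit -/

section CommutingSum

set_option linter.unusedSectionVars false

variable {α β γ : Type*} [Fintype α] [DecidableEq α] [Fintype β] [DecidableEq β]
  [Fintype γ] [DecidableEq γ]
variable {R : Type*} [CommRing R] [Algebra ℂ R] (ζ : ℕ → ℂ) (s τ : ℕ → R)

/-- The weight of a pair of commuting permutations. -/
def pairWeight (x z : Perm α) : R :=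
  linearValue ζ x z • (cycleProd s x * cycleProd τ z)

open Classical in
/-- The pairs of commuting permutations of `α`. -/
def commutingPairs (α : Type*) [Fintype α] [DecidableEq α] : Finset (Perm α × Perm α) :=
  Finset.univ.filter fun P => Commute P.2 P.1

theorem mem_commutingPairs {P : Perm α × Perm α} : P ∈ commutingPairs α ↔ Commute P.2 P.1 := by
  simp [commutingPairs]

/-- The total weight of the pairs of commuting permutations of `α`. -/
def commutingSum (α : Type*) [Fintype α] [DecidableEq α] : R :=
  ∑ P ∈ commutingPairs α, pairWeight ζ s τ P.1 P.2

variable {ζ}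

theorem pairWeight_permCongr (hζ : ∀ i, 0 < i → IsPrimitiveRoot (ζ i) i) (e : α ≃ β)
    {x z : Perm α} (hz : Commute z x) :
    pairWeight ζ s τ (e.permCongr x) (e.permCongr z) = pairWeight ζ s τ x z := by
  rw [pairWeight, linearValue_permCongr hζ e hz, cycleProd_permCongr, cycleProd_permCongr,
    pairWeight]

theorem pairWeight_sumCongr (hζ : ∀ i, 0 < i → IsPrimitiveRoot (ζ i) i)
    {x z : Perm α} (hz : Commute z x) {x' z' : Perm β} (hz' : Commute z' x') :
    pairWeight ζ s τ (Perm.sumCongr x x') (Perm.sumCongr z z') =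
      pairWeight ζ s τ x z * pairWeight ζ s τ x' z' := by
  rw [pairWeight, linearValue_sumCongr hζ hz hz', cycleProd_sumCongr, cycleProd_sumCongr,
    pairWeight, pairWeight, smul_mul_smul_comm]
  congr 1
  ring

theorem exists_sumCongr_eq {X : Perm γ} {y : Perm (γ ⊕ β)}
    (h : ∀ u, y (Sum.inl u) = Sum.inl (X u)) : ∃ x : Perm β, Perm.sumCongr X x = y := by
  have hm : Set.MapsTo y (Set.range Sum.inl) (Set.range Sum.inl) := by
    rintro _ ⟨u, rfl⟩
    exact ⟨X u, (h u).symm⟩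
  obtain ⟨⟨X', x⟩, rfl⟩ := Perm.mem_sumCongrHom_range_of_perm_mapsTo_inl hm
  refine ⟨x, ?_⟩
  have : X = X' := by
    ext u
    have := h u
    simp only [Perm.sumCongrHom_apply, Perm.sumCongr_apply, Sum.map_inl] at this
    exact (Sum.inl_injective this).symm
  rw [this]
  rfl

theorem exists_permCongr_sumCongr_eq (e : γ ⊕ β ≃ α) {X : Perm γ} {y : Perm α}
    (h : ∀ u, y (e (Sum.inl u)) = e (Sum.inl (X u))) :
    ∃ x : Perm β, e.permCongr (Perm.sumCongr X x) = y := by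
  obtain ⟨x, hx⟩ := exists_sumCongr_eq (X := X) (y := e.symm.permCongr y) (by simp [h])
  refine ⟨x, ?_⟩
  rw [hx]
  ext p
  simp

-- A pair prescribed on the copy of `γ` preserves its complement, so what remains free is a
-- commuting pair on `β`; the weight factors accordingly.
open Classical in
theorem sum_intertwining (hζ : ∀ i, 0 < i → IsPrimitiveRoot (ζ i) i) (e : γ ⊕ β ≃ α)
    {X Z : Perm γ} (hXZ : Commute Z X) :
    ∑ P ∈ commutingPairs α with (∀ u, P.1 (e (Sum.inl u)) = e (Sum.inl (X u))) ∧
        ∀ u, P.2 (e (Sum.inl u)) = e (Sum.inl (Z u)), pairWeight ζ s τ P.1 P.2 =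
      pairWeight ζ s τ X Z * commutingSum ζ s τ β := by
  symm
  rw [commutingSum, Finset.mul_sum]
  have hcomm : ∀ {x z : Perm β}, Commute z x →
      Commute (Perm.sumCongr Z z) (Perm.sumCongr X x) := by
    intro x z h
    simp [commute_iff_eq, Perm.sumCongr_mul, hXZ.eq, h.eq]
  refine Finset.sum_bij (fun P _ => (e.permCongr (Perm.sumCongr X P.1),
    e.permCongr (Perm.sumCongr Z P.2))) ?_ ?_ ?_ ?_
  · intro P hP
    rw [mem_commutingPairs] at hP
    simp only [Finset.mem_filter, mem_commutingPairs]
    exact ⟨(hcomm hP).map e.permCongrHom, by simp, by simp⟩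
  · rintro ⟨x, z⟩ _ ⟨x', z'⟩ _ h
    simp only [Prod.mk.injEq, EmbeddingLike.apply_eq_iff_eq] at h
    have inj : ∀ {Y : Perm γ} {a b : Perm β}, Perm.sumCongr Y a = Perm.sumCongr Y b → a = b := by
      intro Y a b hab
      ext q
      have := congrArg (fun f : Perm (γ ⊕ β) => f (Sum.inr q)) hab
      simpa using this
    rw [inj h.1, inj h.2]
  · rintro ⟨x, z⟩ hP
    simp only [Finset.mem_filter, mem_commutingPairs] at hP
    obtain ⟨hc, h1, h2⟩ := hP
    obtain ⟨x', rfl⟩ := exists_permCongr_sumCongr_eq e h1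
    obtain ⟨z', rfl⟩ := exists_permCongr_sumCongr_eq e h2
    refine ⟨(x', z'), ?_, rfl⟩
    rw [mem_commutingPairs]
    ext q
    have := congrArg (fun f : Perm α => f (e (Sum.inr q))) hc.eq
    simpa using this
  · intro P hP
    rw [mem_commutingPairs] at hP
    rw [pairWeight_permCongr s τ hζ e (hcomm hP), pairWeight_sumCongr s τ hζ hXZ hP]

open Classical in
/-- The number of ways to extend an injection of one summand to a bijection. -/
theorem card_extensions {φ : γ → α} (hφ : Function.Injective φ)
    (hcard : Fintype.card α = Fintype.card γ + Fintype.card β) :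
    (Finset.univ.filter fun e : γ ⊕ β ≃ α => ∀ u, e (Sum.inl u) = φ u).card =
      (Fintype.card β).factorial := by
  have hc : Fintype.card β = Fintype.card ((Set.range φ)ᶜ : Set α) := by
    rw [Fintype.card_compl_set, Set.card_range_of_injective hφ]
    omega
  let e₀ : γ ⊕ β ≃ α :=
    (Equiv.sumCongr (Equiv.ofInjective φ hφ) (Fintype.equivOfCardEq hc)).trans
      (Equiv.Set.sumCompl (Set.range φ))
  have he₀ : ∀ u, e₀ (Sum.inl u) = φ u := fun u => by simp [e₀]
  rw [← Fintype.card_perm, ← Finset.card_univ]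
  symm
  -- Every extension differs from the reference extension `e₀` by a permutation of `β`.
  refine Finset.card_bij (fun σ _ => (Perm.sumCongr 1 σ).trans e₀) ?_ ?_ ?_
  · intro σ _
    simp [he₀]
  · intro σ _ σ' _ h
    ext q
    have := congrArg (fun f : γ ⊕ β ≃ α => f (Sum.inr q)) h
    simpa using this
  · intro e he
    simp only [Finset.mem_filter, Finset.mem_univ, true_and] at he
    obtain ⟨σ, hσ⟩ := exists_sumCongr_eq (X := (1 : Perm γ)) (y := e.trans e₀.symm)
      (by simp [he, ← he₀])
    refine ⟨σ, Finset.mem_univ _, ?_⟩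
    rw [hσ]
    ext q
    simp

/-- The orbit of `p` under `x` and `z` is isomorphic to `γ` with base point `u₀`, acted upon
by `X` and `Z`. -/
def HasOrbitType (X Z : Perm γ) (u₀ : γ) (x z : Perm α) (p : α) : Prop :=
  ∃ φ : γ → α, Function.Injective φ ∧ φ u₀ = p ∧ (∀ u, x (φ u) = φ (X u)) ∧
    ∀ u, z (φ u) = φ (Z u)

theorem intertwining_pow {f : γ → α} {X : Perm γ} {x : Perm α} (h : ∀ u, x (f u) = f (X u))
    (k : ℕ) (u : γ) : (x ^ k) (f u) = f ((X ^ k) u) := by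
  induction k with
  | zero => simp
  | succ k ih => rw [pow_succ', pow_succ', Perm.mul_apply, Perm.mul_apply, ih, h]

-- As `X` and `Z` act transitively on `γ`, an intertwining injection is determined by the image of
-- `u₀`. The fibre over each admissible image consists of the extensions to `β`, hence the
-- factorial.
open Classical in
theorem card_intertwining {X Z : Perm γ} {u₀ : γ}
    (htrans : ∀ u, ∃ a b : ℕ, (X ^ a) ((Z ^ b) u₀) = u) (x z : Perm α)
    (hcard : Fintype.card α = Fintype.card γ + Fintype.card β) :
    (Finset.univ.filter fun e : γ ⊕ β ≃ α => (∀ u, x (e (Sum.inl u)) = e (Sum.inl (X u))) ∧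
        ∀ u, z (e (Sum.inl u)) = e (Sum.inl (Z u))).card =
      (Fintype.card β).factorial *
        (Finset.univ.filter fun p : α => HasOrbitType X Z u₀ x z p).card := by
  rw [Finset.card_eq_sum_card_fiberwise (f := fun e : γ ⊕ β ≃ α => e (Sum.inl u₀))
    (t := Finset.univ.filter fun p : α => HasOrbitType X Z u₀ x z p)]
  · rw [Finset.sum_const_nat (m := (Fintype.card β).factorial), mul_comm]
    intro p hp
    simp only [Finset.mem_filter, Finset.mem_univ, true_and] at hp
    obtain ⟨φ, hφ, hφp, h1, h2⟩ := hp
    rw [← card_extensions hφ hcard]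
    congr 1
    ext e
    simp only [Finset.mem_filter, Finset.mem_univ, true_and]
    constructor
    · rintro ⟨⟨h3, h4⟩, h5⟩ u
      obtain ⟨a, b, rfl⟩ := htrans u
      rw [← intertwining_pow (f := fun u => e (Sum.inl u)) h3,
        ← intertwining_pow (f := fun u => e (Sum.inl u)) h4, h5, ← intertwining_pow h1,
        ← intertwining_pow h2, hφp]
    · intro h
      simp [h, h1, h2, hφp]
  · intro e he
    simp only [Finset.coe_filter, Finset.mem_univ, true_and, Set.mem_ofPred_eq] at he ⊢
    exact ⟨fun u => e (Sum.inl u), e.injective.comp Sum.inl_injective, rfl, he⟩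

-- Double counting of a commuting pair together with a bijection `γ ⊕ β ≃ α` intertwining it with
-- `(X, Z)`: fixing the pair uses `card_intertwining`, fixing the bijection uses `sum_intertwining`.
open Classical in
theorem sum_card_hasOrbitType (hζ : ∀ i, 0 < i → IsPrimitiveRoot (ζ i) i) {X Z : Perm γ}
    (hXZ : Commute Z X) {u₀ : γ} (htrans : ∀ u, ∃ a b : ℕ, (X ^ a) ((Z ^ b) u₀) = u)
    (hcard : Fintype.card α = Fintype.card γ + Fintype.card β) :
    (Fintype.card β).factorial • ∑ P ∈ commutingPairs α,
        (Finset.univ.filter fun p : α => HasOrbitType X Z u₀ P.1 P.2 p).card •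
          pairWeight ζ s τ P.1 P.2 =
      (Fintype.card α).factorial • (pairWeight ζ s τ X Z * commutingSum ζ s τ β) := by
  have h1 : ∀ P ∈ commutingPairs α, (Fintype.card β).factorial •
      (Finset.univ.filter fun p : α => HasOrbitType X Z u₀ P.1 P.2 p).card •
          pairWeight ζ s τ P.1 P.2 =
      ∑ e : γ ⊕ β ≃ α, if (∀ u, P.1 (e (Sum.inl u)) = e (Sum.inl (X u))) ∧
        ∀ u, P.2 (e (Sum.inl u)) = e (Sum.inl (Z u)) then pairWeight ζ s τ P.1 P.2 else 0 := by
    intro P _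
    rw [← mul_smul, ← card_intertwining (β := β) htrans P.1 P.2 hcard, ← Finset.sum_filter,
      Finset.sum_const]
  rw [Finset.smul_sum, Finset.sum_congr rfl h1, Finset.sum_comm]
  simp_rw [← Finset.sum_filter, sum_intertwining s τ hζ _ hXZ]
  rw [Finset.sum_const, Finset.card_univ,
    Fintype.card_equiv (Fintype.equivOfCardEq (by rw [hcard, Fintype.card_sum])),
    Fintype.card_sum, hcard]

end CommutingSum

/-! ### Models of the transitive commuting pairs -/

section Model

set_option linter.unusedSectionVars false

variable (i m : ℕ) [NeZero i] [NeZero m]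

/-- The first generator in the model of a transitive pair of commuting permutations. -/
def modelX : Perm (ZMod m × ZMod i) :=
  Equiv.prodShear (Equiv.refl _) fun _ => Equiv.addRight 1

/-- The second generator in the model of a transitive pair of commuting permutations. -/
def modelZ (c : ZMod i) : Perm (ZMod m × ZMod i) :=
  Equiv.prodShear (Equiv.addRight 1) fun b => Equiv.addRight (if b = -1 then c else 0)

variable {i m}

theorem modelX_apply (u : ZMod m × ZMod i) : modelX i m u = (u.1, u.2 + 1) := rfl

theorem modelZ_apply (c : ZMod i) (u : ZMod m × ZMod i) :
    modelZ i m c u = (u.1 + 1, u.2 + if u.1 = -1 then c else 0) := rfl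

theorem commute_model (c : ZMod i) : Commute (modelZ i m c) (modelX i m) := by
  ext u <;> simp [modelX_apply, modelZ_apply, add_right_comm]

theorem modelX_pow_apply (k : ℕ) (u : ZMod m × ZMod i) :
    (modelX i m ^ k) u = (u.1, u.2 + k) := by
  induction k with
  | zero => simp
  | succ k ih => rw [pow_succ', Perm.mul_apply, ih, modelX_apply]; push_cast; rw [add_assoc]

theorem modelZ_pow_apply (c : ZMod i) (k : ℕ) (u : ZMod m × ZMod i) :
    (modelZ i m c ^ k) u =
      (u.1 + k, u.2 + ∑ l ∈ Finset.range k, if u.1 + l = -1 then c else 0) := by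
  induction k with
  | zero => simp
  | succ k ih =>
    rw [pow_succ', Perm.mul_apply, ih, modelZ_apply, Finset.sum_range_succ]
    push_cast
    simp only [add_assoc]

theorem modelZ_pow_apply_of_lt (c : ZMod i) {k : ℕ} (hk : k < m) (r : ZMod i) :
    (modelZ i m c ^ k) (0, r) = ((k : ZMod m), r) := by
  rw [modelZ_pow_apply, Finset.sum_eq_zero]
  · simp
  · intro l hl
    rw [if_neg]
    rw [zero_add, eq_neg_iff_add_eq_zero, ← Nat.cast_succ, ZMod.natCast_eq_zero_iff]
    rw [Finset.mem_range] at hl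
    exact Nat.not_dvd_of_pos_of_lt (Nat.succ_pos _) (by omega)

/-- In `m` consecutive steps the first coordinate passes through `-1` exactly once, at step `(-1 -
u.1).val`, so the monodromy `c` is added exactly once. -/
theorem modelZ_pow_self_apply (c : ZMod i) (u : ZMod m × ZMod i) :
    (modelZ i m c ^ m) u = (u.1, u.2 + c) := by
  rw [modelZ_pow_apply, Finset.sum_eq_single (-1 - u.1).val]
  · simp
  · intro l hl hne
    rw [if_neg]
    intro h
    apply hne
    rw [← h, add_sub_cancel_left, ZMod.val_natCast, Nat.mod_eq_of_lt (Finset.mem_range.1 hl)]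
  · intro h
    exact absurd (Finset.mem_range.2 (ZMod.val_lt _)) h

theorem modelZ_pow_mul_apply (c : ZMod i) (j : ℕ) (u : ZMod m × ZMod i) :
    (modelZ i m c ^ (m * j)) u = (u.1, u.2 + j • c) := by
  induction j with
  | zero => simp
  | succ j ih =>
    rw [mul_add, mul_one, add_comm, pow_add, Perm.mul_apply, ih, modelZ_pow_self_apply, add_smul,
      one_smul, add_assoc]

theorem exists_pow_model (c : ZMod i) (u : ZMod m × ZMod i) :
    ∃ a b : ℕ, (modelX i m ^ a) ((modelZ i m c ^ b) 0) = u := by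
  refine ⟨u.2.val, u.1.val, ?_⟩
  rw [show (0 : ZMod m × ZMod i) = (0, 0) from rfl, modelZ_pow_apply_of_lt c (ZMod.val_lt _),
    modelX_pow_apply]
  simp

theorem minimalPeriod_modelX (u : ZMod m × ZMod i) :
    Function.minimalPeriod (modelX i m) u = i := by
  refine Nat.dvd_antisymm ?_ ?_
  · rw [← pow_apply_eq_self_iff_minimalPeriod_dvd, modelX_pow_apply]
    simp
  · have := (pow_apply_eq_self_iff_minimalPeriod_dvd (modelX i m) _ u).2 dvd_rfl
    rw [modelX_pow_apply, Prod.ext_iff] at this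
    simpa [ZMod.natCast_eq_zero_iff] using this.2

/-- A return to the same first coordinate takes a multiple of `m` steps, and each full turn shifts
the second coordinate by `c`. -/
theorem minimalPeriod_modelZ (c : ZMod i) (u : ZMod m × ZMod i) :
    Function.minimalPeriod (modelZ i m c) u = m * addOrderOf c := by
  refine Nat.dvd_antisymm ?_ ?_
  · rw [← pow_apply_eq_self_iff_minimalPeriod_dvd, modelZ_pow_mul_apply,
      addOrderOf_nsmul_eq_zero, add_zero]
  · have := (pow_apply_eq_self_iff_minimalPeriod_dvd (modelZ i m c) _ u).2 dvd_rfl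
    have h1 : m ∣ Function.minimalPeriod (modelZ i m c) u := by
      rw [modelZ_pow_apply, Prod.ext_iff] at this
      simpa [ZMod.natCast_eq_zero_iff] using this.1
    obtain ⟨j, hj⟩ := h1
    rw [hj, modelZ_pow_mul_apply, Prod.ext_iff] at this
    rw [hj]
    exact mul_dvd_mul_left m (addOrderOf_dvd_of_nsmul_eq_zero (by simpa using this.2))

end Model

/-! ### Cycle lengths sum to the number of points -/

section CycleCount

variable {α : Type*} [Fintype α] [DecidableEq α]

open Classical in
theorem card_filter_sameCycle (x : Perm α) (p : α) :
    (Finset.univ.filter fun q => x.SameCycle p q).card = Function.minimalPeriod x p := by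
  have : (Finset.univ.filter fun q => x.SameCycle p q) =
      (Finset.range (Function.minimalPeriod x p)).image fun k => (x ^ k) p := by
    ext q
    simp only [Finset.mem_filter, Finset.mem_univ, true_and, Finset.mem_image, Finset.mem_range]
    constructor
    · intro h
      obtain ⟨k, -, rfl⟩ := h.exists_pow_eq'
      refine ⟨k % Function.minimalPeriod x p, Nat.mod_lt _ (minimalPeriod_perm_pos x p), ?_⟩
      rw [Perm.coe_pow, Perm.coe_pow, Function.iterate_mod_minimalPeriod_eq]
    · rintro ⟨k, -, rfl⟩
      exact ⟨k, by simp⟩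
  rw [this, Finset.card_image_of_injOn, Finset.card_range]
  intro a ha b hb h
  simp only [Perm.coe_pow] at h
  exact Function.iterate_injOn_Iio_minimalPeriod (by simpa using ha) (by simpa using hb) h

theorem sum_minimalPeriod_cycleBases (x : Perm α) :
    ∑ p ∈ cycleBases x, Function.minimalPeriod x p = Fintype.card α := by
  classical
  rw [← Finset.card_univ, Finset.card_eq_sum_card_fiberwise (f := cycleBase x)
    (t := cycleBases x) (fun p _ => cycleBase_mem x p)]
  refine Finset.sum_congr rfl fun p hp => ?_
  rw [← card_filter_sameCycle]
  have hp' : cycleBase x p = p := by simpa [cycleBases] using hp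
  congr 1
  ext q
  simp only [Finset.mem_filter, Finset.mem_univ, true_and]
  rw [← cycleBase_eq_iff, hp', eq_comm]

theorem cycleProd_of_forall_minimalPeriod_eq {M : Type*} [CommMonoid M] (f : ℕ → M)
    {x : Perm α} {L : ℕ} (hL : 0 < L) (h : ∀ p, Function.minimalPeriod x p = L) :
    cycleProd f x = f L ^ (Fintype.card α / L) := by
  have h1 := sum_minimalPeriod_cycleBases x
  simp only [h, Finset.sum_const, smul_eq_mul] at h1
  rw [cycleProd, ← h1, Nat.mul_div_cancel _ hL]
  simp [h]

end CycleCount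

/-! ### Weights of the models and sums of roots of unity -/

section ModelWeight

variable {R : Type*} [CommRing R] [Algebra ℂ R] {ζ : ℕ → ℂ} (s τ : ℕ → R)
variable {i m : ℕ} [NeZero i] [NeZero m]

theorem root_pow_val_add {z : ℂ} (hz : IsPrimitiveRoot z i) (a b : ZMod i) :
    z ^ (a + b).val = z ^ a.val * z ^ b.val := by
  rw [ZMod.val_add, ← pow_add, ← pow_mod_orderOf z (a.val + b.val), ← hz.eq_orderOf]

/-- Use the phase `ζ i ^ r` at `(b, r)` and the transversal `r = 0`. The second generator keeps `r =
0` except at `b = -1`, where it adds `c`; only that point contributes a nontrivial factor. -/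
theorem linearValue_model (hζ : ∀ i, 0 < i → IsPrimitiveRoot (ζ i) i) (c : ZMod i) :
    linearValue ζ (modelX i m) (modelZ i m c) = ζ i ^ c.val := by
  have hz := hζ i (NeZero.pos i)
  have h : IsPhase ζ (modelX i m) fun u => ζ i ^ u.2.val := by
    refine ⟨fun u => pow_ne_zero _ (hz.ne_zero (NeZero.ne i)), fun u => ?_⟩
    rw [minimalPeriod_modelX, modelX_apply, root_pow_val_add hz, mul_comm]
    congr 1
    have h1 := pow_mod_orderOf (ζ i) 1
    rw [← hz.eq_orderOf, pow_one] at h1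
    rw [← Nat.cast_one, ZMod.val_natCast, h1]
  have hB : IsTransversal (modelX i m) (Finset.univ ×ˢ {0}) := by
    intro u
    refine ⟨(u.1, 0), ⟨by simp, Perm.SameCycle.symm ⟨u.2.val, ?_⟩⟩, ?_⟩
    · rw [zpow_natCast, modelX_pow_apply]
      simp
    · rintro v ⟨hv, hc⟩
      obtain ⟨k, -, rfl⟩ := hc.exists_pow_eq'
      rw [modelX_pow_apply] at hv ⊢
      ext
      · rfl
      · simpa [eq_comm] using hv
  rw [← h.prod_div_eq (commute_model c) hB, Finset.prod_product, Finset.prod_eq_single (-1)]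
  · simp [modelZ_apply]
  · intro b _ hb
    simp [modelZ_apply, hb]
  · simp

theorem pairWeight_model (hζ : ∀ i, 0 < i → IsPrimitiveRoot (ζ i) i) (c : ZMod i) :
    pairWeight ζ s τ (modelX i m) (modelZ i m c) =
      ζ i ^ c.val • (s i ^ m * τ (m * addOrderOf c) ^ (i / addOrderOf c)) := by
  rw [pairWeight, linearValue_model hζ,
    cycleProd_of_forall_minimalPeriod_eq s (NeZero.pos i) minimalPeriod_modelX,
    cycleProd_of_forall_minimalPeriod_eq τ (Nat.mul_pos (NeZero.pos m) (addOrderOf_pos c))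
      (minimalPeriod_modelZ c), Fintype.card_prod, ZMod.card, ZMod.card,
    Nat.mul_div_cancel _ (NeZero.pos i), Nat.mul_div_mul_left _ _ (NeZero.pos m)]

/-- The index set is a subgroup containing `q = i / d`. Translation by `q` multiplies the sum by `z
^ q`, which differs from `1` when `d ≠ 1`, so the sum vanishes. -/
theorem sum_root_pow_val_of_nsmul_eq_zero {z : ℂ} (hz : IsPrimitiveRoot z i) {d : ℕ} (hd : d ∣ i) :
    ∑ c : ZMod i with d • c = 0, z ^ c.val = if d = 1 then 1 else 0 := by
  split_ifs with h
  · subst h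
    simp [Finset.filter_eq']
  · obtain ⟨q, hq⟩ := hd
    have hi := NeZero.pos i
    have hq0 : 0 < q := Nat.pos_of_ne_zero fun h0 => by simp [hq, h0] at hi
    have hd1 : 1 < d := by
      rcases d with _ | _ | d
      · simp at hq; omega
      · simp at h
      · omega
    have hqi : q < i := by rw [hq]; nlinarith
    have h1 : ∑ c : ZMod i with d • c = 0, z ^ c.val =
        z ^ q * ∑ c : ZMod i with d • c = 0, z ^ c.val := by
      rw [Finset.mul_sum]
      have hdq : d • (q : ZMod i) = 0 := by
        rw [nsmul_eq_mul, ← Nat.cast_mul, ← hq, ZMod.natCast_self]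
      symm
      refine Finset.sum_bij (fun c _ => (q : ZMod i) + c) ?_ ?_ ?_ ?_
      · intro c hc
        simp only [Finset.mem_filter, Finset.mem_univ, true_and] at hc ⊢
        rw [smul_add, hdq, hc, add_zero]
      · intro a _ b _ hab
        simpa using hab
      · intro c hc
        refine ⟨c - q, ?_, by simp⟩
        simp only [Finset.mem_filter, Finset.mem_univ, true_and] at hc ⊢
        rw [smul_sub, hdq, hc, sub_zero]
      · intro c _
        rw [root_pow_val_add hz, ZMod.val_natCast, Nat.mod_eq_of_lt hqi]
    have h2 : z ^ q ≠ 1 := hz.pow_ne_one_of_pos_of_lt hq0.ne' hqi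
    have h3 : (1 - z ^ q) * ∑ c : ZMod i with d • c = 0, z ^ c.val = 0 := by
      rw [sub_mul, one_mul, ← h1, sub_self]
    exact (mul_eq_zero.1 h3).resolve_left (sub_ne_zero.2 h2.symm)

/-- The sum of the primitive `d`-th roots of unity. -/
theorem sum_root_pow_val_of_addOrderOf_eq {z : ℂ} (hz : IsPrimitiveRoot z i) {d : ℕ}
    (hd : d ∣ i) :
    ∑ c : ZMod i with addOrderOf c = d, z ^ c.val = (ArithmeticFunction.moebius d : ℂ) := by
  have hi := NeZero.pos i
  -- Möbius inversion over the divisors of `i`: adding up the sums over all orders dividing `e`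
  -- gives the sum over `e • c = 0`, known from the previous lemma.
  have key := (ArithmeticFunction.sum_eq_iff_sum_mul_moebius_eq_on (R := ℂ)
    (f := fun d => ∑ c : ZMod i with addOrderOf c = d, z ^ c.val)
    (g := fun d => if d = 1 then 1 else 0) {d | d ∣ i} (fun a b hab hb => hab.trans hb)).1 ?_
  · rw [← key d (Nat.pos_of_dvd_of_pos hd hi) hd, Nat.sum_divisorsAntidiagonal
      (f := fun a b => (ArithmeticFunction.moebius a : ℂ) * if b = 1 then 1 else 0),
      Finset.sum_eq_single d]
    · simp [Nat.div_self (Nat.pos_of_dvd_of_pos hd hi)]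
    · intro e he hne
      rw [if_neg, mul_zero]
      intro h
      apply hne
      have := Nat.div_mul_cancel (Nat.dvd_of_mem_divisors he)
      rw [h, one_mul] at this
      exact this
    · intro h
      simp [(Nat.pos_of_dvd_of_pos hd hi).ne'] at h
  · intro e he hei
    rw [← sum_root_pow_val_of_nsmul_eq_zero hz hei]
    rw [← Finset.sum_fiberwise_of_maps_to (s := Finset.univ.filter fun c : ZMod i => e • c = 0)
      (t := e.divisors) (g := addOrderOf)]
    · refine Finset.sum_congr rfl fun f hf => ?_
      refine Finset.sum_congr ?_ fun _ _ => rfl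
      ext c
      simp only [Finset.mem_filter, Finset.mem_univ, true_and]
      constructor
      · intro h
        refine ⟨?_, h⟩
        rw [← addOrderOf_dvd_iff_nsmul_eq_zero, h]
        exact Nat.dvd_of_mem_divisors hf
      · exact fun h => h.2
    · intro c hc
      simp only [Finset.mem_filter, Finset.mem_univ, true_and] at hc
      exact Nat.mem_divisors.2 ⟨addOrderOf_dvd_of_nsmul_eq_zero hc, he.ne'⟩

theorem sum_root_pow_val_smul {z : ℂ} (hz : IsPrimitiveRoot z i) (g : ℕ → R) :
    ∑ c : ZMod i, z ^ c.val • g (addOrderOf c) =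
      ∑ d ∈ i.divisors, (ArithmeticFunction.moebius d : ℂ) • g d := by
  rw [← Finset.sum_fiberwise_of_maps_to (s := Finset.univ) (t := i.divisors)
    (g := fun c : ZMod i => addOrderOf c)]
  · refine Finset.sum_congr rfl fun d hd => ?_
    rw [← sum_root_pow_val_of_addOrderOf_eq hz (Nat.dvd_of_mem_divisors hd), Finset.sum_smul]
    refine Finset.sum_congr rfl fun c hc => ?_
    rw [(Finset.mem_filter.1 hc).2]
  · intro c _
    refine Nat.mem_divisors.2 ⟨?_, NeZero.ne i⟩
    have := addOrderOf_dvd_card (x := c)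
    rwa [ZMod.card] at this

end ModelWeight

/-! ### Classification of the orbit of a point -/

section OrbitType

set_option linter.unusedSectionVars false

variable {α : Type*} [Fintype α] [DecidableEq α]

/-- A point `p` is in an orbit with `m` cycles of `x` of length `i`, with monodromy `c`. -/
structure PointType (x z : Perm α) (p : α) (i m : ℕ) (c : ZMod i) : Prop where
  pow_apply_eq : ∀ k : ℕ, (x ^ k) p = p ↔ i ∣ k
  sameCycle_pow : ∀ k : ℕ, x.SameCycle p ((z ^ k) p) ↔ m ∣ k
  pow_eq : (z ^ m) p = (x ^ c.val) p

theorem PointType.unique {x z : Perm α} {p : α} {i m i' m' : ℕ} {c : ZMod i} {c' : ZMod i'}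
    (h : PointType x z p i m c) (h' : PointType x z p i' m' c') : i = i' ∧ m = m' :=
  ⟨Nat.dvd_antisymm (by rw [← h.pow_apply_eq, h'.pow_apply_eq])
    (by rw [← h'.pow_apply_eq, h.pow_apply_eq]),
  Nat.dvd_antisymm (by rw [← h.sameCycle_pow, h'.sameCycle_pow])
    (by rw [← h'.sameCycle_pow, h.sameCycle_pow])⟩

theorem pow_apply_eq_pow_apply_of_modEq {x : Perm α} {p : α} {i a b : ℕ} (hp : (x ^ i) p = p)
    (h : a ≡ b [MOD i]) : (x ^ a) p = (x ^ b) p := by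
  have key : ∀ a, (x ^ (a % i)) p = (x ^ a) p := by
    intro a
    conv_rhs => rw [← Nat.mod_add_div a i, pow_add, Perm.mul_apply, pow_mul]
    rw [Perm.pow_apply_eq_self_of_apply_eq_self hp]
  rw [← key a, ← key b, h]

theorem PointType.val_injective {x z : Perm α} {p : α} {i m : ℕ} [NeZero i] {c r r' : ZMod i}
    (h : PointType x z p i m c) (h1 : (x ^ r.val) p = (x ^ r'.val) p) : r = r' := by
  have key : ∀ a b : ℕ, a ≤ b → (x ^ a) p = (x ^ b) p → a ≡ b [MOD i] := by
    intro a b hab hp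
    obtain ⟨d, rfl⟩ := Nat.exists_eq_add_of_le hab
    rw [pow_add, Perm.mul_apply, EmbeddingLike.apply_eq_iff_eq, eq_comm, h.pow_apply_eq] at hp
    exact (Nat.modEq_iff_dvd' hab).2 (by simpa using hp)
  have h2 : r.val ≡ r'.val [MOD i] := by
    rcases le_total r.val r'.val with hle | hle
    · exact key _ _ hle h1
    · exact (key _ _ hle h1.symm).symm
  apply ZMod.val_injective
  rwa [Nat.ModEq, Nat.mod_eq_of_lt (ZMod.val_lt _), Nat.mod_eq_of_lt (ZMod.val_lt _)] at h2

theorem PointType.unique_monodromy {x z : Perm α} {p : α} {i m : ℕ} [NeZero i] {c c' : ZMod i}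
    (h : PointType x z p i m c) (h' : PointType x z p i m c') : c = c' :=
  h.val_injective (h.pow_eq.symm.trans h'.pow_eq)

/-- Given the point type, the embedding of the model is `(b, r) ↦ x^r z^b p`, with `b` and `r`
represented by least residues. -/
theorem hasOrbitType_model_iff {x z : Perm α} (hz : Commute z x) (p : α) {i m : ℕ} [NeZero i]
    [NeZero m] (c : ZMod i) :
    HasOrbitType (modelX i m) (modelZ i m c) 0 x z p ↔ PointType x z p i m c := by
  constructor
  · rintro ⟨φ, hφ, rfl, hX, hZ⟩
    refine ⟨fun k => ?_, fun k => ?_, ?_⟩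
    · rw [intertwining_pow hX, hφ.eq_iff, modelX_pow_apply, Prod.ext_iff]
      simp [ZMod.natCast_eq_zero_iff]
    · rw [intertwining_pow hZ]
      constructor
      · intro h
        obtain ⟨a, -, ha⟩ := h.exists_pow_eq'
        rw [intertwining_pow hX, hφ.eq_iff, modelX_pow_apply, modelZ_pow_apply, Prod.ext_iff] at ha
        rw [← ZMod.natCast_eq_zero_iff]
        simpa using ha.1.symm
      · rintro ⟨j, rfl⟩
        refine ⟨((j • c).val : ℕ), ?_⟩
        rw [zpow_natCast, intertwining_pow hX, modelX_pow_apply, modelZ_pow_mul_apply]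
        simp
    · rw [intertwining_pow hX, intertwining_pow hZ, modelZ_pow_self_apply, modelX_pow_apply]
      simp
  · intro h
    have hxp : (x ^ i) p = p := (h.pow_apply_eq i).2 dvd_rfl
    have hcomm : ∀ (a b : ℕ) (q : α), (z ^ b) ((x ^ a) q) = (x ^ a) ((z ^ b) q) := fun a b q => by
      rw [← Perm.mul_apply, ((hz.pow_left b).pow_right a).eq, Perm.mul_apply]
    have hxz : ∀ b : ℕ, (x ^ i) ((z ^ b) p) = (z ^ b) p := fun b => by
      rw [← hcomm, hxp]
    refine ⟨fun u => (x ^ u.2.val) ((z ^ u.1.val) p), ?_, by simp, ?_, ?_⟩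
    · have key : ∀ u v : ZMod m × ZMod i, u.1.val ≤ v.1.val →
          (x ^ u.2.val) ((z ^ u.1.val) p) = (x ^ v.2.val) ((z ^ v.1.val) p) → u = v := by
        intro u v hle huv
        obtain ⟨d, hd⟩ := Nat.exists_eq_add_of_le hle
        have h1 : x.SameCycle ((z ^ u.1.val) p) ((z ^ u.1.val) ((z ^ d) p)) := by
          rw [← Perm.mul_apply, ← pow_add, ← hd]
          have : x.SameCycle ((x ^ u.2.val) ((z ^ u.1.val) p)) ((x ^ v.2.val) ((z ^ v.1.val) p)) :=
            huv ▸ Perm.SameCycle.refl _ _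
          simpa using this
        have h2 := sameCycle_map (hz.pow_left u.1.val).inv_left h1
        simp only [Perm.coe_inv, symm_apply_apply, h.sameCycle_pow] at h2
        -- The two points lie on one cycle of `x`, so `m` divides the difference `d < m` of their
        -- first coordinates.
        have h3 : d = 0 := Nat.eq_zero_of_dvd_of_lt h2 (by have := ZMod.val_lt v.1; omega)
        have h4 : u.1 = v.1 := ZMod.val_injective _ (by omega)
        refine Prod.ext h4 ?_
        rw [← h4, ← hcomm, ← hcomm, EmbeddingLike.apply_eq_iff_eq] at huv
        exact h.val_injective huv
      intro u v huv
      rcases le_total u.1.val v.1.val with hle | hle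
      · exact key u v hle huv
      · exact (key v u hle huv.symm).symm
    · intro u
      rw [← Perm.mul_apply, ← pow_succ', modelX_apply]
      refine pow_apply_eq_pow_apply_of_modEq (hxz _) ?_
      rw [← ZMod.natCast_eq_natCast_iff]
      simp
    · intro u
      have h1 : ∀ a (q : α), z ((x ^ a) q) = (x ^ a) (z q) := fun a q => by
        simpa using hcomm a 1 q
      rw [h1, ← Perm.mul_apply z, ← pow_succ', modelZ_apply]
      -- At `-1` the first coordinate wraps around, and the resulting `z^m p` is rewritten as `x^c
      -- p`; elsewhere its residue simply increases by one.
      by_cases hu : u.1 = -1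
      · have h2 : u.1.val + 1 = m := by
          have h3 : m ∣ u.1.val + 1 := by
            rw [← ZMod.natCast_eq_zero_iff]
            simp [hu]
          have := Nat.le_of_dvd (Nat.succ_pos _) h3
          have := ZMod.val_lt u.1
          omega
        rw [h2, h.pow_eq, ← Perm.mul_apply, ← pow_add]
        simp only [hu, if_true, neg_add_cancel, ZMod.val_zero, pow_zero, Perm.one_apply]
        refine pow_apply_eq_pow_apply_of_modEq hxp ?_
        rw [← ZMod.natCast_eq_natCast_iff]
        simp
      · have h2 : (u.1 + 1).val = u.1.val + 1 := by
          have h3 : u.1.val + 1 < m := by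
            refine lt_of_le_of_ne (ZMod.val_lt _) fun h4 => hu ?_
            rw [eq_neg_iff_add_eq_zero]
            have := (ZMod.natCast_eq_zero_iff (u.1.val + 1) m).2 (by rw [h4])
            simpa using this
          have h4 := ZMod.val_cast_of_lt h3
          simpa using h4
        simp [hu, h2]

/-- Since `z` commutes with `x`, it acts on the set of cycles of `x`. The second parameter is the
period of the cycle of `p` under this action. Writing both parameters as successors makes them
visibly nonzero. -/
theorem exists_pointType {x z : Perm α} (hz : Commute z x) (p : α) :
    ∃ i m : ℕ, ∃ c : ZMod (i + 1), PointType x z p (i + 1) (m + 1) c := by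
  have hi := minimalPeriod_perm_pos x p
  let f : Quotient (Perm.SameCycle.setoid x) → Quotient (Perm.SameCycle.setoid x) :=
    Quotient.map z fun _ _ h => sameCycle_map hz h
  have hf : ∀ k : ℕ, f^[k] (Quotient.mk _ p) = Quotient.mk _ ((z ^ k) p) := by
    intro k
    induction k with
    | zero => rfl
    | succ k ih => rw [Function.iterate_succ_apply', ih, pow_succ', Perm.mul_apply]; rfl
  have hf' : ∀ k : ℕ, Function.IsPeriodicPt f k (Quotient.mk _ p) ↔ x.SameCycle p ((z ^ k) p) := by
    intro k
    rw [Function.IsPeriodicPt, Function.IsFixedPt, hf, Quotient.eq, Perm.sameCycle_comm]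
    rfl
  have hm : 0 < Function.minimalPeriod f (Quotient.mk _ p) := by
    refine Function.IsPeriodicPt.minimalPeriod_pos (orderOf_pos z) ((hf' _).2 ?_)
    rw [pow_orderOf_eq_one]
    exact Perm.SameCycle.refl _ _
  have hc : x.SameCycle p ((z ^ Function.minimalPeriod f (Quotient.mk _ p)) p) :=
    (hf' _).1 (Function.isPeriodicPt_minimalPeriod f _)
  obtain ⟨k, -, hk⟩ := hc.exists_pow_eq'
  obtain ⟨i, hi'⟩ := Nat.exists_eq_succ_of_ne_zero hi.ne'
  obtain ⟨m, hm'⟩ := Nat.exists_eq_succ_of_ne_zero hm.ne'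
  refine ⟨i, m, (k : ZMod (i + 1)), fun l => ?_, fun l => ?_, ?_⟩
  · rw [pow_apply_eq_self_iff_minimalPeriod_dvd, hi']
  · rw [← hf', Function.isPeriodicPt_iff_minimalPeriod_dvd, hm']
  · rw [← Nat.succ_eq_add_one m, ← hm', ← hk]
    refine pow_apply_eq_pow_apply_of_modEq (i := i + 1) ?_ ?_
    · rw [pow_apply_eq_self_iff_minimalPeriod_dvd, hi']
    · rw [← ZMod.natCast_eq_natCast_iff]
      simp

theorem HasOrbitType.card_le {γ : Type*} [Fintype γ] {X Z : Perm γ} {u₀ : γ} {x z : Perm α}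
    {p : α} (h : HasOrbitType X Z u₀ x z p) : Fintype.card γ ≤ Fintype.card α :=
  have ⟨φ, hφ, _⟩ := h
  Fintype.card_le_of_injective φ hφ

-- Every point has exactly one type. The ranges suffice because the model embeds in `α`, so the
-- product of the two parameters is at most the number of points.
open Classical in
theorem sum_hasOrbitType {x z : Perm α} (hz : Commute z x) (p : α) :
    ∑ i ∈ Finset.range (Fintype.card α), ∑ m ∈ Finset.range (Fintype.card α),
      ∑ c : ZMod (i + 1),
        (if HasOrbitType (modelX (i + 1) (m + 1)) (modelZ (i + 1) (m + 1) c) 0 x z p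
          then 1 else 0) = 1 := by
  simp only [hasOrbitType_model_iff hz]
  obtain ⟨i, m, c, h⟩ := exists_pointType hz p
  have hcard := ((hasOrbitType_model_iff hz p c).2 h).card_le
  rw [Fintype.card_prod, ZMod.card, ZMod.card] at hcard
  rw [Finset.sum_eq_single i, Finset.sum_eq_single m, Finset.sum_eq_single c, if_pos h]
  · intro c' _ hc'
    exact if_neg fun h' => hc' (h'.unique_monodromy h)
  · simp
  · intro m' _ hm'
    refine Finset.sum_eq_zero fun c' _ => if_neg fun h' => hm' ?_
    have := (h'.unique h).2
    omega
  · intro hm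
    rw [Finset.mem_range] at hm
    nlinarith
  · intro i' _ hi'
    refine Finset.sum_eq_zero fun m' _ => Finset.sum_eq_zero fun c' _ => if_neg fun h' => hi' ?_
    have := (h'.unique h).1
    omega
  · intro hi
    rw [Finset.mem_range] at hi
    nlinarith

end OrbitType

/-! ### The recurrence obtained by marking a point -/

section Recurrence

variable {R : Type*} [CommRing R] [Algebra ℂ R] {ζ : ℕ → ℂ} (s τ : ℕ → R)

variable (ζ) in
/-- The total weight of the pairs of commuting permutations of `n` points, divided by `n!`. -/
def normalizedSum (n : ℕ) : R :=
  (n.factorial : ℂ)⁻¹ • commutingSum ζ s τ (Fin n)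

theorem sum_card_hasOrbitType_model (hζ : ∀ i, 0 < i → IsPrimitiveRoot (ζ i) i) (n i m : ℕ)
    [NeZero i] [NeZero m] (c : ZMod i) [∀ P : Perm (Fin n) × Perm (Fin n), DecidablePred
      fun p => HasOrbitType (modelX i m) (modelZ i m c) 0 P.1 P.2 p] :
    ∑ P ∈ commutingPairs (Fin n),
      (Finset.univ.filter fun p => HasOrbitType (modelX i m) (modelZ i m c) 0 P.1 P.2 p).card •
        pairWeight ζ s τ P.1 P.2 =
      if i * m ≤ n then (n.factorial : ℂ) • (pairWeight ζ s τ (modelX i m) (modelZ i m c) *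
        normalizedSum ζ s τ (n - i * m)) else 0 := by
  split_ifs with h
  · have key := sum_card_hasOrbitType (α := Fin n) (β := Fin (n - i * m))
      (γ := ZMod m × ZMod i) s τ hζ (commute_model c)
      (exists_pow_model c) (by
        rw [Fintype.card_prod, ZMod.card, ZMod.card, Fintype.card_fin, Fintype.card_fin,
          mul_comm m i]
        omega)
    simp only [Fintype.card_fin] at key
    rw [← Nat.cast_smul_eq_nsmul ℂ, ← Nat.cast_smul_eq_nsmul ℂ n.factorial] at key
    rw [normalizedSum, mul_smul_comm, smul_comm, ← key, smul_smul, inv_mul_cancel₀ (by exact_mod_cast Nat.factorial_ne_zero _), one_smul]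
    refine Finset.sum_congr rfl fun P _ => ?_
    congr!
  · refine Finset.sum_eq_zero fun P _ => ?_
    rw [Finset.filter_false_of_mem, Finset.card_empty, zero_smul]
    intro p _ hp
    have := hp.card_le
    rw [Fintype.card_prod, ZMod.card, ZMod.card, Fintype.card_fin, mul_comm] at this
    exact h this

/-- The contribution of the transitive pairs with `m` cycles of length `i`. -/
def transitiveTerm (i m : ℕ) : R :=
  ∑ d ∈ i.divisors, (ArithmeticFunction.moebius d : ℂ) • (s i ^ m * τ (m * d) ^ (i / d))

theorem sum_pairWeight_model (hζ : ∀ i, 0 < i → IsPrimitiveRoot (ζ i) i) (i m : ℕ)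
    [NeZero i] [NeZero m] :
    ∑ c : ZMod i, pairWeight ζ s τ (modelX i m) (modelZ i m c) = transitiveTerm s τ i m := by
  simp_rw [pairWeight_model s τ hζ]
  exact sum_root_pow_val_smul (hζ i (NeZero.pos i)) fun d => s i ^ m * τ (m * d) ^ (i / d)

/-- The factor `n` counts a marked point. Sorting by its orbit type and removing that orbit leaves a
commuting pair on the remaining points; the factorials cancel. -/
theorem smul_normalizedSum (hζ : ∀ i, 0 < i → IsPrimitiveRoot (ζ i) i) (n : ℕ) :
    (n : ℂ) • normalizedSum ζ s τ n = ∑ i ∈ Finset.range n, ∑ m ∈ Finset.range n,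
      if (i + 1) * (m + 1) ≤ n then
        transitiveTerm s τ (i + 1) (m + 1) * normalizedSum ζ s τ (n - (i + 1) * (m + 1))
      else 0 := by
  classical
  have hn : (n.factorial : ℂ) ≠ 0 := by exact_mod_cast Nat.factorial_ne_zero n
  have h1 : ∀ P ∈ commutingPairs (Fin n), (n : ℂ) • pairWeight ζ s τ P.1 P.2 =
      ∑ i ∈ Finset.range n, ∑ m ∈ Finset.range n, ∑ c : ZMod (i + 1),
        (Finset.univ.filter fun p => HasOrbitType (modelX (i + 1) (m + 1))
          (modelZ (i + 1) (m + 1) c) 0 P.1 P.2 p).card • pairWeight ζ s τ P.1 P.2 := by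
    intro P hP
    rw [mem_commutingPairs] at hP
    simp_rw [← Finset.sum_smul]
    rw [Nat.cast_smul_eq_nsmul]
    congr 1
    simp_rw [Finset.card_filter]
    have h2 : ∑ p : Fin n, 1 = n := by simp
    conv_lhs => rw [← h2]
    simp_rw [fun i m => Finset.sum_comm (s := (Finset.univ : Finset (ZMod (i + 1))))
      (t := (Finset.univ : Finset (Fin n)))
      (f := fun c p => if HasOrbitType (modelX (i + 1) (m + 1))
          (modelZ (i + 1) (m + 1) c) 0 P.1 P.2 p then 1 else 0)]
    rw [Finset.sum_congr rfl fun i _ => Finset.sum_comm, Finset.sum_comm]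
    refine Finset.sum_congr rfl fun p _ => ?_
    have := sum_hasOrbitType hP p
    rw [Fintype.card_fin] at this
    exact this.symm
  have h3 : (n.factorial : ℂ) • ((n : ℂ) • normalizedSum ζ s τ n) =
      ∑ i ∈ Finset.range n, ∑ m ∈ Finset.range n, ∑ c : ZMod (i + 1),
        ∑ P ∈ commutingPairs (Fin n), (Finset.univ.filter fun p =>
          HasOrbitType (modelX (i + 1) (m + 1)) (modelZ (i + 1) (m + 1) c) 0 P.1 P.2 p).card •
            pairWeight ζ s τ P.1 P.2 := by
    rw [normalizedSum, smul_comm, smul_smul (n.factorial : ℂ), mul_inv_cancel₀ hn, one_smul,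
      commutingSum, Finset.smul_sum, Finset.sum_congr rfl h1, Finset.sum_comm]
    refine Finset.sum_congr rfl fun i _ => ?_
    rw [Finset.sum_comm]
    refine Finset.sum_congr rfl fun m _ => ?_
    rw [Finset.sum_comm]
  apply smul_right_injective R hn
  dsimp only
  rw [h3, Finset.smul_sum]
  refine Finset.sum_congr rfl fun i _ => ?_
  rw [Finset.smul_sum]
  refine Finset.sum_congr rfl fun m _ => ?_
  simp_rw [sum_card_hasOrbitType_model s τ hζ]
  split_ifs
  · rw [← Finset.smul_sum, ← Finset.sum_mul, sum_pairWeight_model s τ hζ]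
  · simp

end Recurrence

/-! ### Euler derivation and formal exponential -/

section WeightDerivation

variable {σ : Type*} (w : σ → ℕ)

/-- The Euler derivation which multiplies each monomial by its weight. -/
def weightDeriv (f : MvPowerSeries σ ℂ) : MvPowerSeries σ ℂ :=
  fun m => (Finsupp.weight w m : ℂ) * MvPowerSeries.coeff m f

theorem coeff_weightDeriv (f : MvPowerSeries σ ℂ) (m : σ →₀ ℕ) :
    MvPowerSeries.coeff m (weightDeriv w f) =
      (Finsupp.weight w m : ℂ) * MvPowerSeries.coeff m f := rfl

theorem weightDeriv_mul (f g : MvPowerSeries σ ℂ) :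
    weightDeriv w (f * g) = weightDeriv w f * g + f * weightDeriv w g := by
  classical
  ext m
  simp only [map_add, coeff_weightDeriv, MvPowerSeries.coeff_mul]
  rw [Finset.mul_sum, ← Finset.sum_add_distrib]
  refine Finset.sum_congr rfl fun p hp => ?_
  rw [← Finset.HasAntidiagonal.mem_antidiagonal.1 hp, map_add]
  push_cast
  ring

theorem weightDeriv_pow_succ (f : MvPowerSeries σ ℂ) (k : ℕ) :
    weightDeriv w (f ^ (k + 1)) = ((k : ℂ) + 1) • (weightDeriv w f * f ^ k) := by
  induction k with
  | zero => simp
  | succ k ih =>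
    rw [pow_succ, weightDeriv_mul, ih, pow_succ]
    simp only [MvPowerSeries.smul_eq_C_mul, map_add, map_one, Nat.cast_add, Nat.cast_one]
    ring

theorem coeff_pow_eq_zero_of_degree_lt {G : MvPowerSeries σ ℂ}
    (hG : MvPowerSeries.constantCoeff G = 0) {m : σ →₀ ℕ} {k : ℕ} (hk : Finsupp.degree m < k) :
    MvPowerSeries.coeff m (G ^ k) = 0 := by
  apply MvPowerSeries.coeff_of_lt_order
  refine lt_of_lt_of_le ?_ (MvPowerSeries.le_order_pow_of_constantCoeff_eq_zero k hG)
  exact_mod_cast hk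

theorem coeff_formalExp {G : MvPowerSeries σ ℂ} (hG : MvPowerSeries.constantCoeff G = 0)
    {m : σ →₀ ℕ} {N : ℕ} (hN : Finsupp.degree m < N) :
    MvPowerSeries.coeff m (formalExp G) =
      ∑ k ∈ Finset.range N, (k.factorial : ℂ)⁻¹ * MvPowerSeries.coeff m (G ^ k) := by
  rw [formalExp, PowerSeries.coeff_subst (PowerSeries.HasSubst.of_constantCoeff_zero hG)]
  rw [finsum_eq_sum_of_support_subset (s := Finset.range N)]
  · refine Finset.sum_congr rfl fun k _ => ?_
    simp [PowerSeries.coeff_exp]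
  · intro k hk
    rw [Finset.coe_range, Set.mem_Iio]
    by_contra h
    refine hk ?_
    dsimp only
    rw [coeff_pow_eq_zero_of_degree_lt hG (by omega), smul_zero]

theorem weightDeriv_formalExp {G : MvPowerSeries σ ℂ} (hG : MvPowerSeries.constantCoeff G = 0) :
    weightDeriv w (formalExp G) = weightDeriv w G * formalExp G := by
  classical
  ext m
  -- One term more than needed is kept, so that after splitting off `k = 0` the remaining range
  -- still covers all powers seen by the factors of degree at most that of `m`.
  rw [coeff_weightDeriv, coeff_formalExp hG (N := Finsupp.degree m + 1 + 1) (by omega),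
    MvPowerSeries.coeff_mul, Finset.sum_range_succ', mul_add, Finset.mul_sum]
  have h0 : (Finsupp.weight w m : ℂ) * (((0 : ℕ).factorial : ℂ)⁻¹ *
      MvPowerSeries.coeff m (G ^ 0)) = 0 := by
    rcases eq_or_ne m 0 with rfl | hm
    · simp
    · simp [MvPowerSeries.coeff_one, hm]
  have h1 : ∀ k ∈ Finset.range (Finsupp.degree m + 1), (Finsupp.weight w m : ℂ) *
      (((k + 1).factorial : ℂ)⁻¹ * MvPowerSeries.coeff m (G ^ (k + 1))) =
      ∑ p ∈ Finset.HasAntidiagonal.antidiagonal m, MvPowerSeries.coeff p.1 (weightDeriv w G) *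
        ((k.factorial : ℂ)⁻¹ * MvPowerSeries.coeff p.2 (G ^ k)) := by
    intro k _
    have hk : ((k : ℂ) + 1) ≠ 0 := by exact_mod_cast Nat.succ_ne_zero k
    rw [mul_left_comm, ← coeff_weightDeriv, weightDeriv_pow_succ, map_smul, smul_eq_mul,
      Nat.factorial_succ, MvPowerSeries.coeff_mul]
    push_cast
    rw [mul_inv, mul_comm _ (k.factorial : ℂ)⁻¹, mul_assoc, inv_mul_cancel_left₀ hk,
      Finset.mul_sum]
    exact Finset.sum_congr rfl fun p _ => by ring
  rw [h0, add_zero, Finset.sum_congr rfl h1, Finset.sum_comm]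
  refine Finset.sum_congr rfl fun p hp => ?_
  rw [coeff_formalExp hG (N := Finsupp.degree m + 1), Finset.mul_sum]
  rw [← Finset.HasAntidiagonal.mem_antidiagonal.1 hp, map_add]
  omega

theorem constantCoeff_formalExp {G : MvPowerSeries σ ℂ}
    (hG : MvPowerSeries.constantCoeff G = 0) :
    MvPowerSeries.coeff 0 (formalExp G) = 1 := by
  rw [coeff_formalExp hG (N := 1) (by simp)]
  simp

/-- Solutions of a logarithmic differential equation are determined by their constant terms. -/
theorem eq_of_weightDeriv_eq (hw : ∀ a, w a ≠ 0) {E F H : MvPowerSeries σ ℂ}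
    (hH : MvPowerSeries.coeff 0 H = 0) (hE : weightDeriv w E = H * E)
    (hF : weightDeriv w F = H * F)
    (h0 : MvPowerSeries.coeff 0 E = MvPowerSeries.coeff 0 F) : E = F := by
  classical
  have : Finsupp.NonTorsionWeight ℕ w := Finsupp.nonTorsionWeight_of _ _ hw
  have key : ∀ n : ℕ, ∀ m : σ →₀ ℕ, Finsupp.weight w m = n →
      MvPowerSeries.coeff m E = MvPowerSeries.coeff m F := by
    intro n
    induction n using Nat.strong_induction_on with
    | _ n ih =>
      intro m hm
      rcases Nat.eq_zero_or_pos n with rfl | hn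
      · rw [Finsupp.weight_eq_zero_iff_eq_zero] at hm
        rw [hm, h0]
      · have hn' : (Finsupp.weight w m : ℂ) ≠ 0 := by
          rw [hm]
          exact_mod_cast hn.ne'
        apply mul_left_cancel₀ hn'
        rw [← coeff_weightDeriv, ← coeff_weightDeriv, hE, hF, MvPowerSeries.coeff_mul,
          MvPowerSeries.coeff_mul]
        refine Finset.sum_congr rfl fun p hp => ?_
        rcases eq_or_ne p.1 0 with h1 | h1
        -- As `H` has no constant term, only coefficients of `E` and `F` of strictly smaller weight
        -- matter.
        · rw [h1, hH, zero_mul, zero_mul]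
        · rw [ih (Finsupp.weight w p.2) _ _ rfl]
          have h2 : Finsupp.weight w p.1 ≠ 0 := by
            rwa [Ne, Finsupp.weight_eq_zero_iff_eq_zero]
          have h3 := congrArg (Finsupp.weight w) (Finset.HasAntidiagonal.mem_antidiagonal.1 hp)
          rw [map_add, hm] at h3
          omega
  ext m
  exact key _ m rfl

end WeightDerivation

/-! ### Weighted homogeneous power series -/

section Homogeneous

variable {σ : Type*} {w : σ → ℕ}

open MvPowerSeries

/-- Every monomial of `f` has weight `p`. -/
def HasWeight (w : σ → ℕ) (f : MvPowerSeries σ ℂ) (p : ℕ) : Prop :=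
  ∀ d, coeff d f ≠ 0 → Finsupp.weight w d = p

theorem HasWeight.mul {f g : MvPowerSeries σ ℂ} {p q : ℕ} (hf : HasWeight w f p)
    (hg : HasWeight w g q) : HasWeight w (f * g) (p + q) := fun _ hd =>
  MvPowerSeries.IsWeightedHomogeneous.mul (fun h => hf _ h) (fun h => hg _ h) hd

theorem hasWeight_one : HasWeight w (1 : MvPowerSeries σ ℂ) 0 := by
  classical
  intro d hd
  rw [coeff_one] at hd
  have : d = 0 := by
    by_contra h
    exact hd (if_neg h)
  simp [this]

theorem hasWeight_X (a : σ) :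
    HasWeight w (X a : MvPowerSeries σ ℂ) (w a) := by
  classical
  intro d hd
  rw [coeff_X] at hd
  have : d = Finsupp.single a 1 := by
    by_contra h
    exact hd (if_neg h)
  simp [this, Finsupp.weight_single]

theorem HasWeight.const_smul {f : MvPowerSeries σ ℂ} {p : ℕ}
    (hf : HasWeight w f p) (c : ℂ) : HasWeight w (c • f) p := by
  intro d hd
  refine hf d fun h => hd ?_
  rw [map_smul, h, smul_zero]

theorem hasWeight_prod {ι : Type*} (B : Finset ι) {f : ι → MvPowerSeries σ ℂ}
    {p : ι → ℕ} (hf : ∀ b ∈ B, HasWeight w (f b) (p b)) :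
    HasWeight w (∏ b ∈ B, f b) (∑ b ∈ B, p b) := by
  classical
  induction B using Finset.induction_on with
  | empty => simpa using hasWeight_one
  | insert b B hb ih =>
    rw [Finset.prod_insert hb, Finset.sum_insert hb]
    exact (hf b (Finset.mem_insert_self b B)).mul
      (ih fun c hc => hf c (Finset.mem_insert_of_mem hc))

theorem hasWeight_sum {ι : Type*} (B : Finset ι) {f : ι → MvPowerSeries σ ℂ}
    {p : ℕ} (hf : ∀ b ∈ B, HasWeight w (f b) p) :
    HasWeight w (∑ b ∈ B, f b) p := by
  intro d hd
  rw [map_sum] at hd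
  obtain ⟨b, hb, h⟩ := Finset.exists_ne_zero_of_sum_ne_zero hd
  exact hf b hb d h

theorem HasWeight.pow {f : MvPowerSeries σ ℂ} {p : ℕ}
    (hf : HasWeight w f p) (k : ℕ) : HasWeight w (f ^ k) (k * p) := by
  have := hasWeight_prod (Finset.range k) fun _ _ => hf
  simpa using this

end Homogeneous

/-! ### The exponential formula in `ℂ[[s, t]]` -/

section ExponentialFormula

/-- The indeterminate `s_i` indexed by a natural number `i > 0`. -/
def sNat (i : ℕ) : SeriesST := sVar i.toPNat'

/-- The signed indeterminate `(-1)^(j-1) t_j` indexed by a natural number `j > 0`. -/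
def signedT (j : ℕ) : SeriesST := ((-1 : ℂ) ^ (j - 1)) • tVar j.toPNat'

/-- The weight in which `s_i` has weight `i` and `t_j` has weight `j`. -/
def stWeight : ℕ+ ⊕ ℕ+ → ℕ := Sum.elim (fun i => i) (fun j => j)

theorem stWeight_ne_zero (a : ℕ+ ⊕ ℕ+) : stWeight a ≠ 0 := by
  rcases a with a | a <;> simp [stWeight]

theorem hasWeight_sVar (i : ℕ+) : HasWeight stWeight (sVar i) i :=
  hasWeight_X (Sum.inl i)

theorem hasWeight_tVar (j : ℕ+) : HasWeight stWeight (tVar j) j :=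
  hasWeight_X (Sum.inr j)

theorem hasWeight_sNat {i : ℕ} (hi : 0 < i) :
    HasWeight stWeight (sNat i) i := by
  have := hasWeight_sVar i.toPNat'
  rwa [Nat.toPNat'_coe, if_pos hi] at this

theorem hasWeight_signedT {j : ℕ} (hj : 0 < j) :
    HasWeight stWeight (signedT j) j := by
  have := hasWeight_tVar j.toPNat'
  rw [Nat.toPNat'_coe, if_pos hj] at this
  exact HasWeight.const_smul this _

theorem hasWeight_cycleProd {α : Type*} [Fintype α] [DecidableEq α]
    {f : ℕ → SeriesST} (hf : ∀ i, 0 < i → HasWeight stWeight (f i) i) (x : Perm α) :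
    HasWeight stWeight (cycleProd f x) (Fintype.card α) := by
  rw [← sum_minimalPeriod_cycleBases x]
  exact hasWeight_prod _ fun p _ => hf _ (minimalPeriod_perm_pos x p)

/-- Each of the two permutations contributes the sum of its cycle lengths, which is `n`. Distinct
`n` thus occupy distinct weights, and coefficients of the infinite sum are read off from one term.
-/
theorem hasWeight_normalizedSum (ζ : ℕ → ℂ) (n : ℕ) :
    HasWeight stWeight (normalizedSum ζ sNat signedT n) (2 * n) := by
  refine HasWeight.const_smul (hasWeight_sum _ fun P _ => ?_) _
  refine HasWeight.const_smul ?_ _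
  have := (hasWeight_cycleProd (fun i hi => hasWeight_sNat hi) P.1).mul
    (hasWeight_cycleProd (fun j hj => hasWeight_signedT hj) P.2)
  rwa [Fintype.card_fin, ← two_mul] at this

theorem exists_coeff_ne_zero_of_coeff_formalSum_ne_zero {κ σ : Type*}
    {f : κ → MvPowerSeries σ ℂ} {m : σ →₀ ℕ} (hm : MvPowerSeries.coeff m (formalSum f) ≠ 0) :
    ∃ k, MvPowerSeries.coeff m (f k) ≠ 0 := by
  by_contra! h
  exact hm ((finsum_congr h).trans finsum_zero)

section HomogeneousFamily

variable {F : ℕ → SeriesST}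

theorem formallySummable_of_hasWeight
    (hF : ∀ n, HasWeight stWeight (F n) (2 * n)) :
    FormallySummable F := by
  intro m
  refine (Set.finite_Iic (Finsupp.weight stWeight m)).subset fun n hn => ?_
  have := hF n m hn
  rw [Set.mem_Iic]
  omega

theorem coeff_formalSum_of_weight_eq
    (hF : ∀ n, HasWeight stWeight (F n) (2 * n)) {m : ℕ+ ⊕ ℕ+ →₀ ℕ} {n : ℕ}
    (hm : Finsupp.weight stWeight m = 2 * n) :
    MvPowerSeries.coeff m (formalSum F) = MvPowerSeries.coeff m (F n) := by
  change ∑ᶠ k, MvPowerSeries.coeff m (F k) = _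
  refine finsum_eq_single _ n fun k hk => ?_
  by_contra h
  have := hF k m h
  omega

theorem exists_weight_eq_of_coeff_formalSum_ne_zero
    (hF : ∀ n, HasWeight stWeight (F n) (2 * n)) {m : ℕ+ ⊕ ℕ+ →₀ ℕ}
    (hm : MvPowerSeries.coeff m (formalSum F) ≠ 0) :
    ∃ n, Finsupp.weight stWeight m = 2 * n := by
  obtain ⟨k, hk⟩ := exists_coeff_ne_zero_of_coeff_formalSum_ne_zero hm
  exact ⟨k, hF k m hk⟩

end HomogeneousFamily

/-- The monomial `s_i^(j/e) t_j^(i/e)`. -/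
def exponentMonomial (i j e : ℕ) : SeriesST :=
  sNat i ^ (j / e) * tVar j.toPNat' ^ (i / e)

theorem hasWeight_exponentMonomial {i j e : ℕ} (hi : 0 < i) (hj : 0 < j)
    (he : e ∈ (Nat.gcd i j).divisors) :
    HasWeight stWeight (exponentMonomial i j e) (2 * (i * (j / e))) := by
  have h1 := (hasWeight_sNat hi).pow (j / e)
  have h2 := (hasWeight_tVar j.toPNat').pow (i / e)
  rw [Nat.toPNat'_coe, if_pos hj] at h2
  have h3 := h1.mul h2
  have he' := Nat.dvd_of_mem_divisors he
  obtain ⟨a, ha⟩ := he'.trans (Nat.gcd_dvd_left i j)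
  obtain ⟨b, hb⟩ := he'.trans (Nat.gcd_dvd_right i j)
  have he0 : 0 < e := Nat.pos_of_mem_divisors he
  have h4 : j / e * i + i / e * j = 2 * (i * (j / e)) := by
    rw [ha, hb, Nat.mul_div_cancel_left _ he0, Nat.mul_div_cancel_left _ he0]
    ring
  rwa [h4] at h3

/-- The coefficient of a monomial in the exponent, up to the factor `i * j / e`. -/
def exponentCoeff (i j e : ℕ) : ℂ :=
  (-1) ^ (i * (j - 1) / e) * (ArithmeticFunction.moebius e : ℂ)

theorem signedExponentTerm_eq (p : ℕ+ × ℕ+) :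
    signedExponentTerm p = ∑ e ∈ (Nat.gcd p.1 p.2).divisors,
      (exponentCoeff p.1 p.2 e / ((p.1 : ℂ) * (p.2 : ℂ) / (e : ℂ))) •
        exponentMonomial p.1 p.2 e := by
  simp [signedExponentTerm, exponentCoeff, exponentMonomial, sNat]

/-- The monomial for `e` has weight `2ij/e`, and `ij/e` is at least `i` and at least `j` because `e`
divides both. This bounds the pairs contributing to a given monomial. -/
theorem le_weight_of_coeff_signedExponentTerm_ne_zero {a : ℕ+ ⊕ ℕ+ →₀ ℕ} {p : ℕ+ × ℕ+}
    (h : MvPowerSeries.coeff a (signedExponentTerm p) ≠ 0) :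
    ∃ k : ℕ, Finsupp.weight stWeight a = 2 * k ∧ (p.1 : ℕ) ≤ k ∧ (p.2 : ℕ) ≤ k := by
  rw [signedExponentTerm_eq, map_sum] at h
  obtain ⟨e, he, h⟩ := Finset.exists_ne_zero_of_sum_ne_zero h
  rw [map_smul] at h
  have h1 := hasWeight_exponentMonomial p.1.pos p.2.pos he a
    (right_ne_zero_of_mul h)
  refine ⟨_, h1, ?_, ?_⟩
  · refine Nat.le_mul_of_pos_right _ (Nat.div_pos ?_ (Nat.pos_of_mem_divisors he))
    exact Nat.le_of_dvd p.2.pos ((Nat.dvd_of_mem_divisors he).trans (Nat.gcd_dvd_right _ _))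
  · obtain ⟨b, hb⟩ := (Nat.dvd_of_mem_divisors he).trans (Nat.gcd_dvd_right _ _)
    have hle := Nat.le_of_dvd p.1.pos ((Nat.dvd_of_mem_divisors he).trans (Nat.gcd_dvd_left _ _))
    rw [hb, Nat.mul_div_cancel_left _ (Nat.pos_of_mem_divisors he)]
    exact Nat.mul_le_mul_right b hle

theorem formallySummable_signedExponentTerm : FormallySummable signedExponentTerm := by
  intro a
  have hf : {i : ℕ+ | (i : ℕ) ≤ Finsupp.weight stWeight a}.Finite :=
    (Set.finite_Iic (Finsupp.weight stWeight a)).preimage PNat.coe_injective.injOn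
  refine (hf.prod hf).subset fun p hp => ?_
  obtain ⟨k, hk, h1, h2⟩ := le_weight_of_coeff_signedExponentTerm_ne_zero hp
  exact ⟨by simp only [Set.mem_ofPred_eq]; omega, by simp only [Set.mem_ofPred_eq]; omega⟩

theorem coeff_formalSum_signedExponentTerm {a : ℕ+ ⊕ ℕ+ →₀ ℕ} {n : ℕ}
    (ha : Finsupp.weight stWeight a ≤ 2 * n) :
    MvPowerSeries.coeff a (formalSum signedExponentTerm) =
      ∑ i ∈ Finset.range n, ∑ j ∈ Finset.range n,
        MvPowerSeries.coeff a (signedExponentTerm (i.succPNat, j.succPNat)) := by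
  change ∑ᶠ p, MvPowerSeries.coeff a (signedExponentTerm p) = _
  rw [finsum_eq_sum_of_support_subset (s := (Finset.range n ×ˢ Finset.range n).map
    ⟨Prod.map Nat.succPNat Nat.succPNat,
      Nat.succPNat_injective.prodMap Nat.succPNat_injective⟩)]
  · rw [Finset.sum_map, Finset.sum_product]
    rfl
  · intro p hp
    obtain ⟨k, hk, h1, h2⟩ := le_weight_of_coeff_signedExponentTerm_ne_zero hp
    simp only [Finset.coe_map, Set.mem_image, Finset.mem_coe, Finset.mem_product,
      Finset.mem_range]
    refine ⟨(p.1.natPred, p.2.natPred), ⟨?_, ?_⟩, ?_⟩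
    · have := p.1.natPred_add_one
      omega
    · have := p.2.natPred_add_one
      omega
    · simp

/-- The weight `2ij/e` cancels the denominator `ij/e` of the exponent and leaves the factor `2`. -/
theorem coeff_weightDeriv_formalSum {a : ℕ+ ⊕ ℕ+ →₀ ℕ} {n : ℕ}
    (ha : Finsupp.weight stWeight a ≤ 2 * n) :
    MvPowerSeries.coeff a (weightDeriv stWeight (formalSum signedExponentTerm)) =
      2 * ∑ i ∈ Finset.range n, ∑ j ∈ Finset.range n,
        ∑ e ∈ (Nat.gcd (i + 1) (j + 1)).divisors, exponentCoeff (i + 1) (j + 1) e *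
          MvPowerSeries.coeff a (exponentMonomial (i + 1) (j + 1) e) := by
  rw [coeff_weightDeriv, coeff_formalSum_signedExponentTerm ha]
  simp_rw [Finset.mul_sum, signedExponentTerm_eq, map_sum, Finset.mul_sum]
  refine Finset.sum_congr rfl fun i _ => Finset.sum_congr rfl fun j _ =>
    Finset.sum_congr rfl fun e he => ?_
  simp only [Nat.succPNat_coe, Nat.succ_eq_add_one] at he ⊢
  rw [map_smul, smul_eq_mul]
  by_cases h : MvPowerSeries.coeff a (exponentMonomial (i + 1) (j + 1) e) = 0
  · simp [h]
  · have hw := hasWeight_exponentMonomial (Nat.succ_pos i) (Nat.succ_pos j) he _ h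
    have he0 : (e : ℂ) ≠ 0 := by exact_mod_cast (Nat.pos_of_mem_divisors he).ne'
    have hi : ((i + 1 : ℕ) : ℂ) ≠ 0 := by exact_mod_cast Nat.succ_ne_zero i
    have hj : ((j + 1 : ℕ) : ℂ) ≠ 0 := by exact_mod_cast Nat.succ_ne_zero j
    rw [hw]
    push_cast [Nat.cast_div ((Nat.dvd_of_mem_divisors he).trans (Nat.gcd_dvd_right _ _)) he0] at *
    field_simp

theorem constantCoeff_formalSum_signedExponentTerm :
    MvPowerSeries.constantCoeff (formalSum signedExponentTerm) = 0 := by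
  rw [← MvPowerSeries.coeff_zero_eq_constantCoeff_apply,
    coeff_formalSum_signedExponentTerm (n := 0) (by simp)]
  simp

/-- This is the substitution `j = m d` for fixed `i` and `d ∣ i`, with all indices shifted by one.
The range of `j` is large enough since `m d ≤ m i ≤ n`. -/
theorem sum_divisors_reindex {R : Type*} [AddCommMonoid R] (n : ℕ) (f : ℕ → ℕ → ℕ → R) :
    (∑ i ∈ Finset.range n, ∑ m ∈ Finset.range n,
      if (i + 1) * (m + 1) ≤ n then ∑ d ∈ (i + 1).divisors, f (i + 1) (m + 1) d else 0) =
    ∑ i ∈ Finset.range n, ∑ j ∈ Finset.range n, ∑ e ∈ (Nat.gcd (i + 1) (j + 1)).divisors,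
      if (i + 1) * ((j + 1) / e) ≤ n then f (i + 1) ((j + 1) / e) e else 0 := by
  refine Finset.sum_congr rfl fun i _ => ?_
  have h1 : ∀ j ∈ Finset.range n, (∑ e ∈ (Nat.gcd (i + 1) (j + 1)).divisors,
      if (i + 1) * ((j + 1) / e) ≤ n then f (i + 1) ((j + 1) / e) e else 0) =
      ∑ e ∈ (i + 1).divisors, if e ∣ j + 1 ∧ (i + 1) * ((j + 1) / e) ≤ n then
        f (i + 1) ((j + 1) / e) e else 0 := by
    intro j _
    simp_rw [ite_and]
    rw [← Finset.sum_filter (fun e => e ∣ j + 1)]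
    refine Finset.sum_congr ?_ fun _ _ => rfl
    ext e
    simp [Nat.dvd_gcd_iff]
  have h2 : ∀ m ∈ Finset.range n,
      (if (i + 1) * (m + 1) ≤ n then ∑ d ∈ (i + 1).divisors, f (i + 1) (m + 1) d else 0) =
      ∑ d ∈ (i + 1).divisors, if (i + 1) * (m + 1) ≤ n then f (i + 1) (m + 1) d else 0 := by
    intro m _
    split_ifs <;> simp
  rw [Finset.sum_congr rfl h1, Finset.sum_congr rfl h2, Finset.sum_comm, Finset.sum_comm (t :=
    (i + 1).divisors)]
  refine Finset.sum_congr rfl fun d hd => ?_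
  have hd0 := Nat.pos_of_mem_divisors hd
  have hdi := Nat.le_of_dvd (Nat.succ_pos i) (Nat.dvd_of_mem_divisors hd)
  rw [← Finset.sum_filter, ← Finset.sum_filter]
  refine Finset.sum_bij' (fun m _ => (m + 1) * d - 1) (fun j _ => (j + 1) / d - 1) ?_ ?_ ?_ ?_ ?_
  · intro m hm
    simp only [Finset.mem_filter, Finset.mem_range] at hm ⊢
    have hpos : 0 < (m + 1) * d := Nat.mul_pos (Nat.succ_pos m) hd0
    rw [Nat.sub_add_cancel hpos, Nat.mul_div_cancel _ hd0]
    refine ⟨?_, Dvd.intro_left _ rfl, hm.2⟩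
    have : (m + 1) * d ≤ (i + 1) * (m + 1) := by
      rw [mul_comm]
      exact Nat.mul_le_mul_right _ hdi
    omega
  · intro j hj
    simp only [Finset.mem_filter, Finset.mem_range] at hj ⊢
    have hpos : 0 < (j + 1) / d := Nat.div_pos (Nat.le_of_dvd (Nat.succ_pos j) hj.2.1) hd0
    have := Nat.div_le_self (j + 1) d
    rw [Nat.sub_add_cancel hpos]
    exact ⟨by omega, hj.2.2⟩
  · intro m hm
    have hpos : 0 < (m + 1) * d := Nat.mul_pos (Nat.succ_pos m) hd0
    rw [Nat.sub_add_cancel hpos, Nat.mul_div_cancel _ hd0, Nat.add_sub_cancel]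
  · intro j hj
    simp only [Finset.mem_filter, Finset.mem_range] at hj
    have hpos : 0 < (j + 1) / d := Nat.div_pos (Nat.le_of_dvd (Nat.succ_pos j) hj.2.1) hd0
    rw [Nat.sub_add_cancel hpos, Nat.div_mul_cancel hj.2.1, Nat.add_sub_cancel]
  · intro m hm
    have hpos : 0 < (m + 1) * d := Nat.mul_pos (Nat.succ_pos m) hd0
    rw [Nat.sub_add_cancel hpos, Nat.mul_div_cancel _ hd0]

theorem signedT_pow (i j e : ℕ) (he : e ∣ i) :
    signedT j ^ (i / e) = ((-1 : ℂ) ^ (i * (j - 1) / e)) • tVar j.toPNat' ^ (i / e) := by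
  rw [signedT, smul_pow, ← pow_mul, mul_comm (j - 1), Nat.div_mul_right_comm he]

theorem smul_normalizedSum_eq {ζ : ℕ → ℂ} (hζ : ∀ i, 0 < i → IsPrimitiveRoot (ζ i) i) (n : ℕ) :
    (n : ℂ) • normalizedSum ζ sNat signedT n =
      ∑ i ∈ Finset.range n, ∑ j ∈ Finset.range n, ∑ e ∈ (Nat.gcd (i + 1) (j + 1)).divisors,
        if (i + 1) * ((j + 1) / e) ≤ n then
          (exponentCoeff (i + 1) (j + 1) e • exponentMonomial (i + 1) (j + 1) e) *
            normalizedSum ζ sNat signedT (n - (i + 1) * ((j + 1) / e))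
        else 0 := by
  rw [smul_normalizedSum _ _ hζ]
  simp only [transitiveTerm, Finset.sum_mul]
  rw [sum_divisors_reindex n fun i m d => (ArithmeticFunction.moebius d : ℂ) •
    (sNat i ^ m * signedT (m * d) ^ (i / d)) * normalizedSum ζ sNat signedT (n - i * m)]
  refine Finset.sum_congr rfl fun i _ => Finset.sum_congr rfl fun j _ =>
    Finset.sum_congr rfl fun e he => ?_
  have he' := Nat.dvd_of_mem_divisors he
  rw [Nat.div_mul_cancel (he'.trans (Nat.gcd_dvd_right _ _)),
    signedT_pow _ _ _ (he'.trans (Nat.gcd_dvd_left _ _)), mul_smul_comm, smul_smul,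
    mul_comm (_ : ℂ), exponentCoeff, exponentMonomial]

/-- In weight `2n` this is twice the recurrence `smul_normalizedSum_eq`; in odd weight both sides
vanish. -/
theorem weightDeriv_formalSum_normalizedSum {ζ : ℕ → ℂ}
    (hζ : ∀ i, 0 < i → IsPrimitiveRoot (ζ i) i) :
    weightDeriv stWeight (formalSum (normalizedSum ζ sNat signedT)) =
      weightDeriv stWeight (formalSum signedExponentTerm) *
        formalSum (normalizedSum ζ sNat signedT) := by
  classical
  have hF := hasWeight_normalizedSum ζ
  ext m
  rw [coeff_weightDeriv, MvPowerSeries.coeff_mul]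
  by_cases hm : ∃ n, Finsupp.weight stWeight m = 2 * n
  · obtain ⟨n, hn⟩ := hm
    rw [coeff_formalSum_of_weight_eq hF hn, hn, Nat.cast_mul, mul_assoc, ← smul_eq_mul (n : ℂ),
      ← map_smul, smul_normalizedSum_eq hζ]
    simp_rw [map_sum, Finset.mul_sum]
    have h1 : ∀ p ∈ Finset.HasAntidiagonal.antidiagonal m,
        MvPowerSeries.coeff p.1 (weightDeriv stWeight (formalSum signedExponentTerm)) *
          MvPowerSeries.coeff p.2 (formalSum (normalizedSum ζ sNat signedT)) =
        ∑ i ∈ Finset.range n, ∑ j ∈ Finset.range n,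
          ∑ e ∈ (Nat.gcd (i + 1) (j + 1)).divisors, 2 * (exponentCoeff (i + 1) (j + 1) e *
            MvPowerSeries.coeff p.1 (exponentMonomial (i + 1) (j + 1) e) *
            MvPowerSeries.coeff p.2 (formalSum (normalizedSum ζ sNat signedT))) := by
      intro p hp
      have hw := congrArg (Finsupp.weight stWeight) (Finset.HasAntidiagonal.mem_antidiagonal.1 hp)
      rw [map_add, hn] at hw
      rw [coeff_weightDeriv_formalSum (n := n) (by omega)]
      simp_rw [Finset.mul_sum, Finset.sum_mul, mul_assoc]
    refine ((Finset.sum_congr rfl h1).trans (Finset.sum_comm.trans (Finset.sum_congr rfl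
      fun i _ => Finset.sum_comm.trans (Finset.sum_congr rfl fun j _ => Finset.sum_comm.trans
        (Finset.sum_congr rfl fun e he => ?_))))).symm
    symm
    rw [← Finset.mul_sum, Nat.cast_ofNat]
    congr 1
    -- If the exponent monomial has a nonzero coefficient at `p.1`, then the weight of `p.2` is
    -- determined, and it singles out one summand of the second series.
    have h2 : ∀ p ∈ Finset.HasAntidiagonal.antidiagonal m,
        exponentCoeff (i + 1) (j + 1) e *
            MvPowerSeries.coeff p.1 (exponentMonomial (i + 1) (j + 1) e) *
            MvPowerSeries.coeff p.2 (formalSum (normalizedSum ζ sNat signedT)) =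
        if (i + 1) * ((j + 1) / e) ≤ n then
          MvPowerSeries.coeff p.1 (exponentCoeff (i + 1) (j + 1) e •
            exponentMonomial (i + 1) (j + 1) e) *
          MvPowerSeries.coeff p.2
            (normalizedSum ζ sNat signedT (n - (i + 1) * ((j + 1) / e))) else 0 := by
      intro p hp
      have hw := congrArg (Finsupp.weight stWeight) (Finset.HasAntidiagonal.mem_antidiagonal.1 hp)
      rw [map_add, hn] at hw
      rw [map_smul, smul_eq_mul]
      by_cases h : MvPowerSeries.coeff p.1 (exponentMonomial (i + 1) (j + 1) e) = 0
      · simp [h]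
      · have hw' := hasWeight_exponentMonomial (Nat.succ_pos i) (Nat.succ_pos j) he _ h
        rw [Nat.succ_eq_add_one, Nat.succ_eq_add_one] at hw'
        rw [if_pos (by omega), coeff_formalSum_of_weight_eq hF
          (n := n - (i + 1) * ((j + 1) / e)) (by omega)]
    rw [Finset.sum_congr rfl h2]
    split_ifs with h
    · rw [MvPowerSeries.coeff_mul]
    · simp
  · have h0 : MvPowerSeries.coeff m (formalSum (normalizedSum ζ sNat signedT)) = 0 := by
      by_contra h
      exact hm (exists_weight_eq_of_coeff_formalSum_ne_zero hF h)
    rw [h0, mul_zero]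
    symm
    refine Finset.sum_eq_zero fun p hp => ?_
    by_contra h
    obtain ⟨l, hl⟩ := exists_weight_eq_of_coeff_formalSum_ne_zero hF (right_ne_zero_of_mul h)
    have h1 := right_ne_zero_of_mul (left_ne_zero_of_mul h)
    obtain ⟨q, hq⟩ := exists_coeff_ne_zero_of_coeff_formalSum_ne_zero h1
    obtain ⟨k, hk, -⟩ := le_weight_of_coeff_signedExponentTerm_ne_zero hq
    have hw := congrArg (Finsupp.weight stWeight) (Finset.HasAntidiagonal.mem_antidiagonal.1 hp)
    rw [map_add] at hw
    exact hm ⟨k + l, by omega⟩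

theorem normalizedSum_zero (ζ : ℕ → ℂ) : normalizedSum ζ sNat signedT 0 = 1 := by
  have h : commutingPairs (Fin 0) = {(1, 1)} := by
    ext P
    rw [mem_commutingPairs]
    simp [Subsingleton.elim P (1, 1)]
  rw [normalizedSum, commutingSum, h]
  have h' : cycleBases (1 : Perm (Fin 0)) = ∅ := Finset.eq_empty_of_isEmpty _
  simp [pairWeight, linearValue, cycleProd, h']

/-- The exponential formula for the total weights of pairs of commuting permutations. -/
theorem formalSum_normalizedSum {ζ : ℕ → ℂ} (hζ : ∀ i, 0 < i → IsPrimitiveRoot (ζ i) i) :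
    formalSum (normalizedSum ζ sNat signedT) = formalExp (formalSum signedExponentTerm) := by
  have hG := constantCoeff_formalSum_signedExponentTerm
  refine eq_of_weightDeriv_eq stWeight stWeight_ne_zero ?_
    (weightDeriv_formalSum_normalizedSum hζ) (weightDeriv_formalExp stWeight hG) ?_
  · rw [coeff_weightDeriv, map_zero, Nat.cast_zero, zero_mul]
  · rw [constantCoeff_formalExp hG, coeff_formalSum_of_weight_eq
      (hasWeight_normalizedSum ζ) (n := 0) (by simp), normalizedSum_zero]
    simp

end ExponentialFormula

/-! ### Cycle products, signs and monomials in terms of cycle type -/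

section CycleType

variable {α : Type*} [Fintype α] [DecidableEq α]

theorem support_cycleOf_card_eq_minimalPeriod {x : Perm α} {p : α} (hp : x p ≠ p) :
    (x.cycleOf p).support.card = Function.minimalPeriod x p := by
  classical
  rw [← card_filter_sameCycle]
  congr 1
  ext q
  rw [Finset.mem_filter, Perm.mem_support_cycleOf_iff' hp]
  simp

/-- Fixed points are their own base points and give the parts `1`; the other base points correspond
through `cycleOf` to the nontrivial cycle factors. -/
theorem parts_partition_eq (x : Perm α) :
    x.partition.parts = (cycleBases x).val.map (Function.minimalPeriod x) := by
  have hfix : ∀ p, x p = p → cycleBase x p = p := by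
    intro p hp
    obtain ⟨k, -, hk⟩ := (cycleBase_sameCycle x p).symm.exists_pow_eq'
    rw [← hk, Perm.pow_apply_eq_self_of_apply_eq_self hp]
  rw [Perm.parts_partition, ← Finset.filter_union_filter_not_eq (fun p => x p = p) (cycleBases x),
    add_comm, ← Finset.disjUnion_eq_union _ _ (Finset.disjoint_filter_filter_not _ _ _),
    Finset.disjUnion_val, Multiset.map_add]
  congr 1
  · have h1 : (cycleBases x).filter (fun p => x p = p) = x.supportᶜ := by
      ext p
      simp only [Finset.mem_filter, Finset.mem_compl, Perm.mem_support, not_not, cycleBases,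
        Finset.mem_univ, true_and]
      exact ⟨fun h => h.2, fun h => ⟨hfix p h, h⟩⟩
    rw [h1, ← Finset.card_compl, eq_comm, Multiset.eq_replicate]
    refine ⟨by simp, fun b hb => ?_⟩
    obtain ⟨p, hp, rfl⟩ := Multiset.mem_map.1 hb
    rw [Function.minimalPeriod_eq_one_iff_isFixedPt]
    have hp' : x p = p := by simpa using hp
    exact hp'
  · have hinj : Set.InjOn (x.cycleOf) ((cycleBases x).filter fun p => ¬ x p = p) := by
      intro p hp q hq h
      simp only [Finset.coe_filter, Set.mem_ofPred_eq] at hp hq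
      refine (isTransversal_cycleBases x p).unique ⟨hp.1, Perm.SameCycle.refl _ _⟩ ⟨hq.1, ?_⟩
      have : q ∈ (x.cycleOf p).support := by
        rw [h, Perm.mem_support_cycleOf_iff]
        simp [hq.2, Perm.SameCycle.refl]
      rw [Perm.mem_support_cycleOf_iff] at this
      exact this.1
    have himage : x.cycleFactorsFinset =
        ((cycleBases x).filter fun p => ¬ x p = p).image x.cycleOf := by
      ext c
      rw [Finset.mem_image]
      constructor
      · intro hc
        have hc' := (Perm.mem_cycleFactorsFinset_iff.1 hc).1
        obtain ⟨p, hp⟩ := hc'.nonempty_support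
        have hcp := Perm.cycle_is_cycleOf hp hc
        have hp' : x p ≠ p := by
          rw [← Perm.mem_support]
          exact Perm.mem_cycleFactorsFinset_support_le hc hp
        have hs := cycleBase_sameCycle x p
        refine ⟨cycleBase x p, ?_, ?_⟩
        · rw [Finset.mem_filter]
          exact ⟨cycleBase_mem x p, fun h => hp' (hs.apply_eq_self_iff.1 h)⟩
        · rw [hcp, hs.cycleOf_eq]
      · rintro ⟨p, hp, rfl⟩
        rw [Perm.cycleOf_mem_cycleFactorsFinset_iff, Perm.mem_support]
        exact (Finset.mem_filter.1 hp).2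
    rw [Perm.cycleType_def, himage, Finset.image_val_of_injOn hinj, Multiset.map_map]
    refine Multiset.map_congr rfl fun p hp => ?_
    exact support_cycleOf_card_eq_minimalPeriod (Finset.mem_filter.1 hp).2

theorem cycleProd_eq_prod_parts {M : Type*} [CommMonoid M] (f : ℕ → M) (x : Perm α) :
    cycleProd f x = (x.partition.parts.map f).prod := by
  rw [parts_partition_eq, Multiset.map_map]
  rfl

theorem sign_eq_cycleProd (x : Perm α) :
    ((Perm.sign x : ℤ) : ℂ) = cycleProd (fun j => (-1 : ℂ) ^ (j - 1)) x := by
  rw [cycleProd_eq_prod_parts, Perm.parts_partition, Multiset.map_add, Multiset.prod_add,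
    Perm.sign_of_cycleType']
  simp only [Multiset.map_replicate, Nat.sub_self, pow_zero, Multiset.prod_replicate, one_pow,
    mul_one]
  let φ : ℤˣ →* ℂ := (Int.castRingHom ℂ).toMonoidHom.comp (Units.coeHom ℤ)
  change φ _ = _
  rw [map_multiset_prod, Multiset.map_map]
  congr 1
  refine Multiset.map_congr rfl fun j hj => ?_
  obtain ⟨k, rfl⟩ := Nat.exists_eq_succ_of_ne_zero
    (lt_of_lt_of_le two_pos (Perm.two_le_of_mem_cycleType hj)).ne'
  simp [φ, pow_succ]

theorem cycleProd_signedT (x : Perm α) :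
    cycleProd signedT x = ((Perm.sign x : ℤ) : ℂ) • cycleProd (fun j => tVar j.toPNat') x := by
  rw [sign_eq_cycleProd]
  simp only [cycleProd, signedT]
  rw [Finset.prod_smul]

theorem finprod_pow_count {M : Type*} [CommMonoid M] (f : ℕ+ → M) {n : ℕ} (lam : n.Partition) :
    ∏ᶠ i : ℕ+, f i ^ lam.parts.count (i : ℕ) = (lam.parts.map fun i => f i.toPNat').prod := by
  have hpos : ∀ i ∈ lam.parts.toFinset, ((i.toPNat' : ℕ+) : ℕ) = i := by
    intro i hi
    rw [Nat.toPNat'_coe, if_pos (lam.parts_pos (Multiset.mem_toFinset.1 hi))]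
  rw [finprod_eq_prod_of_mulSupport_subset (s := lam.parts.toFinset.image Nat.toPNat'),
    Finset.prod_multiset_map_count, Finset.prod_image]
  · exact Finset.prod_congr rfl fun i hi => by rw [hpos i hi]
  · intro a ha b hb hab
    rw [← hpos a ha, ← hpos b hb, hab]
  · intro i hi
    rw [Finset.coe_image, Set.mem_image]
    refine ⟨i, ?_, by simp⟩
    rw [Finset.mem_coe, Multiset.mem_toFinset]
    by_contra h
    refine hi ?_
    dsimp only
    rw [Multiset.count_eq_zero_of_notMem h, pow_zero]

variable {n : ℕ}

theorem HasCycleType.cycleProd_sNat {x : Perm (Fin n)} {lam : n.Partition}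
    (h : HasCycleType x lam) : cycleProd sNat x = sMonomial lam := by
  rw [cycleProd_eq_prod_parts, h, sMonomial, finprod_pow_count]
  rfl

theorem HasCycleType.cycleProd_signedT {x : Perm (Fin n)} {lam : n.Partition}
    (h : HasCycleType x lam) :
    cycleProd signedT x = ((Perm.sign x : ℤ) : ℂ) • tMonomial lam := by
  rw [_root_.cycleProd_signedT, cycleProd_eq_prod_parts, h, tMonomial, finprod_pow_count]

theorem HasCycleType.isConj_iff {x y : Perm (Fin n)} {lam : n.Partition}
    (h : HasCycleType x lam) : IsConj x y ↔ HasCycleType y lam := by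
  rw [Perm.partition_eq_of_isConj, Nat.Partition.ext_iff, h, eq_comm, HasCycleType]

theorem existsUnique_hasCycleType (x : Perm (Fin n)) :
    ∃! lam : n.Partition, HasCycleType x lam := by
  refine ⟨⟨x.partition.parts, x.partition.parts_pos, ?_⟩, rfl, fun lam h => ?_⟩
  · simpa using x.partition.parts_sum
  · exact Nat.Partition.ext h.symm

end CycleType

/-! ### Sums over conjugacy classes -/

section ClassSum

variable {n : ℕ} {V : Type*} [AddCommGroup V] [Module ℂ V]

theorem card_isConj_mul_card_centralizer (g : Perm (Fin n)) :
    Nat.card {h : Perm (Fin n) | IsConj g h} * Nat.card (Subgroup.centralizer {g}) =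
      n.factorial := by
  have := Perm.card_isConj_mul_eq g
  rw [← Perm.nat_card_centralizer, Fintype.card_fin] at this
  exact this

/-- By orbit-stabilizer, `1/|Z_y|` is the size of the class of `y` divided by `n!`, and the
partitions index the classes. -/
theorem sum_inv_card_centralizer_smul (y : n.Partition → Perm (Fin n))
    (hy : ∀ nu, HasCycleType (y nu) nu) (h : Perm (Fin n) → V)
    (hh : ∀ a g, h (a * g * a⁻¹) = h g) :
    ∑ nu : n.Partition, (Nat.card (Subgroup.centralizer {y nu}) : ℂ)⁻¹ • h (y nu) =
      (n.factorial : ℂ)⁻¹ • ∑ g, h g := by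
  classical
  have h1 : ∀ g, h g = ∑ nu : n.Partition, if IsConj (y nu) g then h (y nu) else 0 := by
    intro g
    obtain ⟨lam, hlam, hu⟩ := existsUnique_hasCycleType g
    rw [Finset.sum_eq_single lam, if_pos ((hy lam).isConj_iff.2 hlam)]
    · obtain ⟨c, hc⟩ := isConj_iff.1 ((hy lam).isConj_iff.2 hlam)
      rw [← hc, hh]
    · intro nu _ hnu
      exact if_neg fun hc => hnu (hu nu ((hy nu).isConj_iff.1 hc))
    · simp
  have hn : (n.factorial : ℂ) ≠ 0 := by exact_mod_cast Nat.factorial_ne_zero n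
  rw [Finset.sum_congr rfl fun g _ => h1 g, Finset.sum_comm, Finset.smul_sum]
  refine Finset.sum_congr rfl fun nu _ => ?_
  have hc := card_isConj_mul_card_centralizer (y nu)
  have hc' : (Nat.card {g : Perm (Fin n) | IsConj (y nu) g} : ℂ) *
      Nat.card (Subgroup.centralizer {y nu}) = n.factorial := by exact_mod_cast hc
  have hz : (Nat.card (Subgroup.centralizer {y nu}) : ℂ) ≠ 0 := right_ne_zero_of_mul (hc' ▸ hn)
  rw [← Finset.sum_filter, Finset.sum_const, ← Nat.cast_smul_eq_nsmul ℂ, smul_smul]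
  congr 1
  have hcard : (Finset.univ.filter fun g => IsConj (y nu) g).card =
      Nat.card {g : Perm (Fin n) | IsConj (y nu) g} := by
    rw [Nat.card_eq_fintype_card, ← Set.toFinset_card]
    congr 1
    ext g
    simp
  rw [hcard, ← hc']
  rw [← hc'] at hn
  field_simp
  rw [div_self (left_ne_zero_of_mul hn)]

end ClassSum

/-! ### Induced characters -/

section Induced

variable {G : Type*} [Group G] [Fintype G] (H : Subgroup G) (χ : H →* ℂ)

open Classical in
/-- The extension by zero of a linear character of a subgroup. -/
def extendByZero (g : G) : ℂ := if h : g ∈ H then χ ⟨g, h⟩ else 0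

theorem inducedCharacter_eq (g : G) :
    inducedCharacter H χ g = (Nat.card H : ℂ)⁻¹ * ∑ a : G, extendByZero H χ (a⁻¹ * g * a) := rfl

theorem inducedCharacter_conj (b g : G) :
    inducedCharacter H χ (b * g * b⁻¹) = inducedCharacter H χ g := by
  rw [inducedCharacter_eq, inducedCharacter_eq]
  congr 1
  refine Fintype.sum_equiv (Equiv.mulLeft b⁻¹) _ _ fun a => ?_
  congr 1
  simp [mul_assoc]

/-- A form of Frobenius reciprocity: conjugating the summation variable makes the sum independent of
the conjugating element `a`. -/
theorem sum_inducedCharacter_smul {V : Type*} [AddCommGroup V] [Module ℂ V] (T : G → V)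
    (hT : ∀ a g, T (a * g * a⁻¹) = T g) :
    ∑ g, inducedCharacter H χ g • T g =
      (Fintype.card G : ℂ) • ((Nat.card H : ℂ)⁻¹ • ∑ g, extendByZero H χ g • T g) := by
  simp_rw [inducedCharacter_eq, mul_smul, Finset.sum_smul]
  rw [← Finset.smul_sum, smul_comm, Finset.sum_comm]
  congr 1
  rw [Nat.cast_smul_eq_nsmul, ← Finset.card_univ, ← Finset.sum_const]
  refine Finset.sum_congr rfl fun a _ => ?_
  refine Fintype.sum_equiv (MulAut.conj a⁻¹).toEquiv _ _ fun g => ?_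
  have : T (a⁻¹ * g * a) = T g := by simpa using hT a⁻¹ g
  simp [this]

end Induced

/-! ### From higher Lie characters to commuting pairs -/

section CentralizerSum

variable {n : ℕ} {ζ : ℕ → ℂ}

open Classical in
/-- The total weight of the permutations which commute with `x`. -/
def centralizerSum (ζ : ℕ → ℂ) (x : Perm (Fin n)) : SeriesST :=
  ∑ z : Perm (Fin n), (if Commute z x then linearValue ζ x z else 0) • cycleProd signedT z

theorem extendByZero_higherLieLinear (hζ : ∀ i, 0 < i → IsPrimitiveRoot (ζ i) i)
    (x z : Perm (Fin n)) [Decidable (Commute z x)] :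
    extendByZero (Subgroup.centralizer {x}) (higherLieLinear x ζ hζ) z =
      if Commute z x then linearValue ζ x z else 0 := by
  have h : z ∈ Subgroup.centralizer {x} ↔ Commute z x := by
    rw [Subgroup.mem_centralizer_singleton_iff]
    exact Iff.rfl
  rw [extendByZero]
  by_cases hz : Commute z x
  · rw [dif_pos (h.2 hz), if_pos hz]
    rfl
  · rw [dif_neg fun h' => hz (h.1 h'), if_neg hz]

theorem cycleProd_conj {α M : Type*} [Fintype α] [DecidableEq α] [CommMonoid M] (f : ℕ → M)
    (a g : Perm α) : cycleProd f (a * g * a⁻¹) = cycleProd f g :=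
  cycleProd_permCongr f a g

theorem centralizerSum_conj (hζ : ∀ i, 0 < i → IsPrimitiveRoot (ζ i) i) (a x : Perm (Fin n)) :
    centralizerSum ζ (a * x * a⁻¹) = centralizerSum ζ x := by
  symm
  refine Fintype.sum_equiv (MulAut.conj a).toEquiv _ _ fun z => ?_
  have h : Commute (a * z * a⁻¹) (a * x * a⁻¹) ↔ Commute z x := by
    simp only [commute_iff_eq, mul_assoc, inv_mul_cancel_left, mul_right_inj]
    rw [← mul_assoc z, ← mul_assoc x, mul_left_inj]
  have hconj : (MulAut.conj a).toEquiv z = a * z * a⁻¹ := rfl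
  rw [hconj, cycleProd_conj]
  by_cases hz : Commute z x
  · rw [if_pos hz, if_pos (h.2 hz)]
    congr 1
    exact (linearValue_permCongr hζ a hz).symm
  · rw [if_neg hz, if_neg fun h' => hz (h.1 h')]

/-- The class sum is applied to `x`. This needs a class function of `x`, hence one family `ζ` for
all partitions. -/
theorem sum_smul_centralizerSum (x : n.Partition → Perm (Fin n))
    (hx : ∀ lam, HasCycleType (x lam) lam) (hζ : ∀ i, 0 < i → IsPrimitiveRoot (ζ i) i) :
    ∑ lam : n.Partition, (Nat.card (Subgroup.centralizer {x lam}) : ℂ)⁻¹ •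
      (sMonomial lam * centralizerSum ζ (x lam)) = normalizedSum ζ sNat signedT n := by
  classical
  have h := sum_inv_card_centralizer_smul x hx
    (fun g => cycleProd sNat g * centralizerSum ζ g) (fun a g => by
      rw [cycleProd_conj, centralizerSum_conj hζ])
  simp only [(hx _).cycleProd_sNat] at h
  rw [h, normalizedSum]
  congr 1
  rw [commutingSum, commutingPairs, Finset.sum_filter, ← Finset.univ_product_univ,
    Finset.sum_product]
  refine Finset.sum_congr rfl fun g _ => ?_
  rw [centralizerSum, Finset.mul_sum]
  refine Finset.sum_congr rfl fun z _ => ?_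
  rw [mul_smul_comm]
  by_cases hz : Commute z g
  · rw [if_pos hz, if_pos hz, pairWeight]
  · rw [if_neg hz, if_neg hz, zero_smul]

theorem sum_higherLieCharacter (y : n.Partition → Perm (Fin n))
    (hy : ∀ nu, HasCycleType (y nu) nu) (hζ : ∀ i, 0 < i → IsPrimitiveRoot (ζ i) i)
    (x : Perm (Fin n)) (lam : n.Partition) :
    ∑ nu : n.Partition, ((((Perm.sign (y nu) : ℤ) : ℂ) * higherLieCharacter x ζ hζ (y nu)) /
      (Nat.card (Subgroup.centralizer {y nu}) : ℂ)) • (sMonomial lam * tMonomial nu) =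
    (Nat.card (Subgroup.centralizer {x}) : ℂ)⁻¹ • (sMonomial lam * centralizerSum ζ x) := by
  classical
  have h := sum_inv_card_centralizer_smul y hy
    (fun g => higherLieCharacter x ζ hζ g • cycleProd signedT g) (fun a g => by
      rw [cycleProd_conj, higherLieCharacter, inducedCharacter_conj, ← higherLieCharacter])
  have h2 := sum_inducedCharacter_smul (Subgroup.centralizer {x}) (higherLieLinear x ζ hζ)
    (cycleProd signedT) (fun a g => cycleProd_conj _ a g)
  have hn : (n.factorial : ℂ) ≠ 0 := by exact_mod_cast Nat.factorial_ne_zero n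
  have h3 : ∑ g, higherLieCharacter x ζ hζ g • cycleProd signedT g =
      (n.factorial : ℂ) • ((Nat.card (Subgroup.centralizer {x}) : ℂ)⁻¹ •
        centralizerSum ζ x) := by
    refine h2.trans ?_
    rw [Fintype.card_perm, Fintype.card_fin, centralizerSum]
    simp_rw [extendByZero_higherLieLinear hζ]
  rw [h3, smul_smul, inv_mul_cancel₀ hn, one_smul] at h
  rw [← mul_smul_comm, ← h, Finset.mul_sum]
  refine Finset.sum_congr rfl fun nu _ => ?_
  rw [(hy nu).cycleProd_signedT, smul_smul, smul_smul, mul_smul_comm]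
  congr 1
  ring

/-- The weight which counts the indeterminate `s_i`. -/
def countS (i : ℕ+) : ℕ+ ⊕ ℕ+ → ℕ := Pi.single (Sum.inl i) 1

theorem hasWeight_countS_sMonomial (i : ℕ+) (lam : n.Partition) :
    HasWeight (countS i) (sMonomial lam) (lam.parts.count (i : ℕ)) := by
  classical
  rw [sMonomial, finprod_pow_count, Finset.prod_multiset_map_count]
  have h := hasWeight_prod (w := countS i) lam.parts.toFinset
    (f := fun j => sVar j.toPNat' ^ lam.parts.count j)
    (p := fun j => lam.parts.count j * countS i (Sum.inl j.toPNat'))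
    (fun j _ => (hasWeight_X (Sum.inl j.toPNat')).pow _)
  convert h using 1
  rw [Finset.sum_eq_single (i : ℕ)]
  · simp [countS]
  · intro j hj hne
    have hj0 := lam.parts_pos (Multiset.mem_toFinset.1 hj)
    have : j.toPNat' ≠ i := by
      rintro rfl
      rw [Nat.toPNat'_coe, if_pos hj0] at hne
      exact hne rfl
    simp [countS, this]
  · intro hi
    rw [Multiset.mem_toFinset] at hi
    rw [Multiset.count_eq_zero_of_notMem hi, zero_mul]

theorem hasWeight_countS_centralizerSum (i : ℕ+) (x : Perm (Fin n)) :
    HasWeight (countS i) (centralizerSum ζ x) 0 := by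
  refine hasWeight_sum _ fun z _ => HasWeight.const_smul ?_ _
  have h := hasWeight_prod (w := countS i) (cycleBases z)
    (f := fun p => signedT (Function.minimalPeriod z p)) (p := fun _ => 0) (fun p _ => by
      have h1 := hasWeight_X (w := countS i) (Sum.inr (Function.minimalPeriod z p).toPNat')
      have h2 : countS i (Sum.inr (Function.minimalPeriod z p).toPNat') = 0 := by simp [countS]
      rw [h2] at h1
      exact h1.const_smul _)
  rwa [Finset.sum_const_zero] at h

theorem eq_of_forall_count_eq {lam lam' : n.Partition}
    (h : ∀ i : ℕ+, lam.parts.count (i : ℕ) = lam'.parts.count (i : ℕ)) : lam = lam' := by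
  refine Nat.Partition.ext (Multiset.ext.2 fun i => ?_)
  rcases Nat.eq_zero_or_pos i with rfl | hi
  · rw [Multiset.count_eq_zero_of_notMem fun h0 => (lam.parts_pos h0).ne' rfl,
      Multiset.count_eq_zero_of_notMem fun h0 => (lam'.parts_pos h0).ne' rfl]
  · exact h ⟨i, hi⟩

/-- Only one partition contributes to the coefficient of a given monomial. -/
theorem count_eq_of_coeff_ne_zero {m : ℕ+ ⊕ ℕ+ →₀ ℕ} {lam : n.Partition} {x : Perm (Fin n)} {c : ℂ}
    (h : MvPowerSeries.coeff m (c • (sMonomial lam * centralizerSum ζ x)) ≠ 0) (i : ℕ+) :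
    m (Sum.inl i) = lam.parts.count (i : ℕ) := by
  classical
  have h1 := ((hasWeight_countS_sMonomial i lam).mul
    (hasWeight_countS_centralizerSum (ζ := ζ) i x)).const_smul c m h
  rwa [countS, Finsupp.weight_single_one_apply, add_zero] at h1

/-- The `s`-exponents of `m` match at most one partition `lam₀`. All other terms have coefficient
zero whatever their characters, so `ζ lam₀` may be used throughout. -/
theorem exists_coeff_sum_eq (x : n.Partition → Perm (Fin n))
    (hx : ∀ lam, HasCycleType (x lam) lam) (ζ : n.Partition → ℕ → ℂ)
    (hζ : ∀ lam i, 0 < i → IsPrimitiveRoot (ζ lam i) i) (m : ℕ+ ⊕ ℕ+ →₀ ℕ) :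
    ∃ lam₀, MvPowerSeries.coeff m (∑ lam : n.Partition,
      (Nat.card (Subgroup.centralizer {x lam}) : ℂ)⁻¹ •
        (sMonomial lam * centralizerSum (ζ lam) (x lam))) =
      MvPowerSeries.coeff m (normalizedSum (ζ lam₀) sNat signedT n) := by
  have key : ∃ lam₀ : n.Partition, ∀ lam, lam ≠ lam₀ → ∃ i : ℕ+,
      m (Sum.inl i) ≠ lam.parts.count (i : ℕ) := by
    by_cases h : ∃ lam₀ : n.Partition, ∀ i : ℕ+, m (Sum.inl i) = lam₀.parts.count (i : ℕ)
    · obtain ⟨lam₀, h₀⟩ := h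
      refine ⟨lam₀, fun lam hne => ?_⟩
      by_contra! h'
      exact hne (eq_of_forall_count_eq fun i => by rw [← h' i, h₀ i])
    · push Not at h
      -- No partition matches `m`, every term vanishes, and the choice is arbitrary.
      exact ⟨Nat.Partition.indiscrete n, fun lam _ => h lam⟩
  obtain ⟨lam₀, h₀⟩ := key
  refine ⟨lam₀, ?_⟩
  rw [← sum_smul_centralizerSum x hx (hζ lam₀), map_sum, map_sum]
  refine Finset.sum_congr rfl fun lam _ => ?_
  rcases eq_or_ne lam lam₀ with rfl | hne
  · rfl
  · obtain ⟨i, hi⟩ := h₀ lam hne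
    have hz : ∀ ζ' : ℕ → ℂ, MvPowerSeries.coeff m
        ((Nat.card (Subgroup.centralizer {x lam}) : ℂ)⁻¹ •
          (sMonomial lam * centralizerSum ζ' (x lam))) = 0 := fun ζ' => by
      by_contra h
      exact hi (count_eq_of_coeff_ne_zero h i)
    rw [hz, hz]

end CentralizerSum

end

theorem theorem4p1
    -- for each partition, permutations of that cycle type, at which the class functions are taken
    (x y : ∀ n : ℕ, n.Partition → Equiv.Perm (Fin n))
    (hx : ∀ (n : ℕ) (lam : n.Partition), HasCycleType (x n lam) lam)
    (hy : ∀ (n : ℕ) (nu : n.Partition), HasCycleType (y n nu) nu)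
    -- the choices of primitive characters of the cyclic groups
    (ζ : ∀ n : ℕ, n.Partition → ℕ → ℂ)
    (hζ : ∀ (n : ℕ) (lam : n.Partition) (i : ℕ), 0 < i → IsPrimitiveRoot (ζ n lam i) i) :
    FormallySummable signedExponentTerm ∧ PowerSeries.HasSubst (formalSum signedExponentTerm) ∧
      HasFormalSum
        (fun n : ℕ => ∑ lam : n.Partition, ∑ nu : n.Partition,
          ((((Equiv.Perm.sign (y n nu) : ℤ) : ℂ)
              * higherLieCharacter (x n lam) (ζ n lam) (hζ n lam) (y n nu))
            / (Nat.card (Subgroup.centralizer {y n nu}) : ℂ)) •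
            (sMonomial lam * tMonomial nu))
        (formalExp (formalSum signedExponentTerm)) := by
  refine ⟨formallySummable_signedExponentTerm, PowerSeries.HasSubst.of_constantCoeff_zero
    constantCoeff_formalSum_signedExponentTerm, ?_⟩
  simp_rw [fun (n : ℕ) (lam : n.Partition) => sum_higherLieCharacter (y n) (hy n) (hζ n lam)
    (x n lam) lam]
  have hcoeff := fun n => exists_coeff_sum_eq (x n) (hx n) (ζ n) (hζ n)
  have hF : ∀ n, HasWeight stWeight (∑ lam : n.Partition,
      (Nat.card (Subgroup.centralizer {x n lam}) : ℂ)⁻¹ •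
        (sMonomial lam * centralizerSum (ζ n lam) (x n lam))) (2 * n) := by
    intro n m hm
    obtain ⟨lam₀, h₀⟩ := hcoeff n m
    rw [h₀] at hm
    exact hasWeight_normalizedSum _ n m hm
  refine ⟨formallySummable_of_hasWeight hF, ?_⟩
  ext m
  by_cases hm : ∃ n, Finsupp.weight stWeight m = 2 * n
  · obtain ⟨n, hn⟩ := hm
    obtain ⟨lam₀, h₀⟩ := hcoeff n m
    -- The exponent does not involve `ζ`, so the exponential formula may be used with whichever
    -- family `m` selects.
    rw [coeff_formalSum_of_weight_eq hF hn, h₀, ← formalSum_normalizedSum (hζ n lam₀),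
      coeff_formalSum_of_weight_eq (hasWeight_normalizedSum _) hn]
  -- In odd weight both coefficients vanish; any family of primitive roots serves to rewrite the
  -- exponential.
  · have hζ₀ := hζ 0 (Nat.Partition.indiscrete 0)
    rw [← formalSum_normalizedSum hζ₀]
    have h1 : ∀ {F : ℕ → SeriesST}, (∀ n, HasWeight stWeight (F n) (2 * n)) →
        MvPowerSeries.coeff m (formalSum F) = 0 := fun hF => by
      by_contra h
      exact hm (exists_weight_eq_of_coeff_formalSum_ne_zero hF h)
    rw [h1 hF, h1 (hasWeight_normalizedSum _)]
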